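/- **Setting.** Fix integers $n\ge 1$, $K\ge 1$ and a constant $\sigma>0$. A *Markov jump affine model* consists of parameters $\theta=(A_k,b_k)_{k=1}^K$ with $A_k\in\mathbb R^{n\times n}$, $b_k\in\mathbb R^n$, a stochastic matrix $P=(p_{ij})\in\mathbb R^{K\times K}$ and noise distributions $f_1,\dots,f_K$ on $\mathbb R^n$. At each time $t\ge 1$ an input $x_t\in\mathbb R^n$ is chosen; then, given the past and $x_t$, the state $s_t=j$ is drawn with probability $p_{s_{t-1},j}$, and $y_t=A_{s_t}x_t+b_{s_t}+w_t$ is observed, where $w_t\sim f_{s_t}$ is independent of the past and of $x_t$ given $s_t$. The initial state $s_0$ has an arbitrary law $\pi_0$. A *policy* $\mu$ chooses $x_t=x_t^\mu$, possibly at random, on the basis of the history $I_{t-1}=(s_0,(x_r,y_r,s_r)_{r=1}^{t-1})$; that is, it prescribes the conditional law of $x_t$ given $I_{t-1}$, and this prescription does not depend on the model. A *sequence of optimal-input estimates* $(\hat x_t^\mu)_{t\ge 1}$ likewise prescribes a conditional law of $\hat x_t^\mu\in\mathbb R^n$ given the history $I_{t-1}$ generated under $\mu$. The stage cost is minus the expected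 revenue, $J(i,x)=\mathbb E(-x\cdot y_t\mid s_{t-1}=i,\,x_t=x)$. When all $A_j$ are negative definite ($x^{\mathsf T}A_jx<0$ for $x\ne0$; symmetry is not required) and the noise has mean zero, it is minimized over $x\in\mathbb R^n$ by the optimal input $$x_i^*=x_i^*(\theta,P)=-\Big(\sum_j p_{ij}(A_j+A_j^{\mathsf T})\Big)^{-1}\sum_j p_{ij}b_j .$$ Let $\Pi\subset\mathbb R^n$ be compact and convex, and let $\Theta\subset(\mathbb R^{n\times n}\times\mathbb R^n)^K$ be compact, with $A_k$ negative definite for every $k$ and every $\theta\in\Theta$. Assume that the set of those $\theta\in\Theta$ whose optimal inputs for equal transition probabilities $p_{ij}=1/K$ lie in $\Pi$ has non-empty interior (this holds, for instance, if $\Theta$ has non-empty interior and $\Pi$ contains the optimal inputs for all $\theta\in\Theta$ and all $P$). A model is *admissible* if $\theta\in\Theta$, $x_i^*(\theta,P)\in\Pi$ for all $i$, and each $f_k$ has mean zero and finite second moments, with $\mathbb E(w_{(l)}^2)\le\sigma^2$ for each entry $w_{(l)}$ of $w\sim f_k$. For $T\ge0$ define, with suprema over all admissible models $(\theta,P,f)$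 and values in $[0,\infty]$, the worst-case cumulative estimation-MSE, the worst-case cumulative input-MSE and the worst-case regret $$\hat{\mathcal E}_T^\mu=\sup\mathbb E\sum_{t=1}^T\|\hat x_t^\mu-x_{s_{t-1}}^*\|_2^2,\qquad \bar{\mathcal E}_T^\mu=\sup\mathbb E\sum_{t=1}^T\|x_t^\mu-x_{s_{t-1}}^*\|_2^2,$$ $$\bar{\mathcal R}_T^\mu=\sup\mathbb E\sum_{t=1}^T\big(J(s_{t-1},x_t^\mu)-J(s_{t-1},x_{s_{t-1}}^*)\big).$$ **Theorem.** There exist constants $C,C'>0$, depending only on $n,K,\Theta,\Pi,\sigma$, such that for every initial law $\pi_0$, every policy $\mu$, every sequence of estimates $(\hat x_t^\mu)$ and every $T$, $$\hat{\mathcal E}_T^\mu\,\bar{\mathcal E}_T^\mu\ge C^2T,\qquad \bar{\mathcal E}_T^\mu\ge C\sqrt T,\qquad \bar{\mathcal R}_T^\mu\ge C'\sqrt T .$$ -/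

import Mathlib

open MeasureTheory ProbabilityTheory
open scoped ENNReal

namespace MarkovJump

noncomputable section

/-- Inputs, outputs and noise live in `ℝⁿ` with the Euclidean norm. -/
abbrev Vec (n : ℕ) : Type := EuclideanSpace ℝ (Fin n)

/-- System parameters `θ = (A_k, b_k)_{k = 1, …, K}`, with `A_k ∈ ℝ^{n × n}` and `b_k ∈ ℝⁿ`. -/
abbrev Param (n K : ℕ) : Type := Fin K → Matrix (Fin n) (Fin n) ℝ × Vec n

/-- A real square matrix, not necessarily symmetric, is negative definite
if `xᵀ A x < 0` for all `x ≠ 0`. -/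
def NegDef {n : ℕ} (A : Matrix (Fin n) (Fin n) ℝ) : Prop :=
  ∀ x : Vec n, x ≠ 0 → inner ℝ x (A.toEuclideanLin x) < 0

/-- The optimal input after the previous state `i`:
`x*_i = - (∑_j p_{ij} (A_j + A_jᵀ))⁻¹ (∑_j p_{ij} b_j)`. That it minimizes the stage cost
is `Model.stageCost_optInput_le` below. -/
def optInput {n K : ℕ} (θ : Param n K) (P : Matrix (Fin K) (Fin K) ℝ) (i : Fin K) : Vec n :=
  -((∑ j, P i j • ((θ j).1 + (θ j).1.transpose))⁻¹.toEuclideanLin (∑ j, P i j • (θ j).2))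

/-- The transition matrix all of whose entries are `1 / K`. -/
def uniformTransition (K : ℕ) : Matrix (Fin K) (Fin K) ℝ := Matrix.of fun _ _ => 1 / (K : ℝ)

/-- A Markov jump affine model: parameters `θ`, a stochastic transition matrix `P` and, for each
state, a noise distribution on `ℝⁿ`. -/
structure Model (n K : ℕ) where
  θ : Param n K
  P : Matrix (Fin K) (Fin K) ℝ
  stochastic : P ∈ Matrix.rowStochastic ℝ (Fin K)
  noise : Fin K → ProbabilityMeasure (Vec n)

namespace Model

variable {n K : ℕ}

/-- The law of `(y_t, s_t)` given `s_{t-1} = i` and `x_t = x`: the state `s_t = j` is drawn with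
probability `p_{ij}`, the noise `w` from the distribution of state `j`, and
`y_t = A_j x + b_j + w`. -/
def outcome (m : Model n K) : Kernel (Fin K × Vec n) (Vec n × Fin K) where
  toFun p := ∑ j, ENNReal.ofReal (m.P p.1 j) •
    (m.noise j : Measure (Vec n)).map
      (fun w => ((m.θ j).1.toEuclideanLin p.2 + (m.θ j).2 + w, j))
  measurable' := by
    refine measurable_from_prod_countable_right fun i => ?_
    refine Measure.measurable_of_measurable_coe _ fun s hs => ?_
    simp only [Measure.coe_finsetSum, Finset.sum_apply, Measure.smul_apply, smul_eq_mul]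
    refine Finset.measurable_sum _ fun j _ => Measurable.const_mul ?_ _
    have hlin : Measurable fun x : Vec n => (m.θ j).1.toEuclideanLin x :=
      (LinearMap.continuous_of_finiteDimensional _).measurable
    have hmap : ∀ x : Vec n, Measurable fun w : Vec n =>
        ((m.θ j).1.toEuclideanLin x + (m.θ j).2 + w, j) := fun x => by fun_prop
    have hpair : Measurable fun q : Vec n × Vec n =>
        ((m.θ j).1.toEuclideanLin q.1 + (m.θ j).2 + q.2, j) := by fun_prop
    simp_rw [fun x => Measure.map_apply (μ := (m.noise j : Measure (Vec n))) (hmap x) hs]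
    exact measurable_measure_prodMk_left (ν := (m.noise j : Measure (Vec n))) (hpair hs)

theorem outcome_apply (m : Model n K) (p : Fin K × Vec n) :
    m.outcome p = ∑ j, ENNReal.ofReal (m.P p.1 j) •
      (m.noise j : Measure (Vec n)).map
        (fun w => ((m.θ j).1.toEuclideanLin p.2 + (m.θ j).2 + w, j)) := rfl

theorem P_nonneg (m : Model n K) (i j : Fin K) : 0 ≤ m.P i j :=
  (Matrix.mem_rowStochastic.1 m.stochastic).1 i j

theorem P_sum (m : Model n K) (i : Fin K) : ∑ j, m.P i j = 1 := by
  have h := congrFun (Matrix.mem_rowStochastic.1 m.stochastic).2 i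
  simpa [Matrix.mulVec, dotProduct] using h

instance (m : Model n K) : IsMarkovKernel m.outcome := by
  refine ⟨fun p => ⟨?_⟩⟩
  rw [outcome_apply]
  simp only [Measure.coe_finsetSum, Finset.sum_apply, Measure.smul_apply, smul_eq_mul]
  have h1 : ∀ j : Fin K, ((m.noise j : Measure (Vec n)).map
      (fun w => ((m.θ j).1.toEuclideanLin p.2 + (m.θ j).2 + w, j))) Set.univ = 1 := fun j => by
    rw [Measure.map_apply (by fun_prop) MeasurableSet.univ]
    simp
  simp_rw [h1, mul_one]
  rw [← ENNReal.ofReal_sum_of_nonneg fun j _ => m.P_nonneg _ _, m.P_sum, ENNReal.ofReal_one]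

/-- The stage cost (minus the expected revenue) `J(i, x) = E(- x · y_t | s_{t-1} = i, x_t = x)`. -/
def stageCost (m : Model n K) (i : Fin K) (x : Vec n) : ℝ :=
  ∫ z, -inner ℝ x z.1 ∂(m.outcome (i, x))

/-- The models over which the worst case is taken: the parameter lies in `Θ`, the optimal inputs
lie in `Π`, and the noise of each state has mean zero, finite variance, and second moments of its
entries at most `σ²`. -/
structure Admissible (Θ : Set (Param n K)) (Pi : Set (Vec n)) (σ : ℝ) (m : Model n K) : Prop where
  mem : m.θ ∈ Θ
  opt_mem : ∀ i, optInput m.θ m.P i ∈ Pi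
  memLp : ∀ k, MemLp (fun w => w) 2 (m.noise k : Measure (Vec n))
  mean_zero : ∀ k, ∫ w, w ∂(m.noise k : Measure (Vec n)) = 0
  second_moment : ∀ k (i : Fin n), ∫ w, w i ^ 2 ∂(m.noise k : Measure (Vec n)) ≤ σ ^ 2

end Model

/-- The information available before `x_{t+1}` is chosen: the initial state `s_0` and the triples
`(x_i, y_i, s_i)` for `i = 1, …, t`. -/
abbrev History (n K t : ℕ) : Type := Fin K × (Fin t → Vec n × Vec n × Fin K)

/-- The most recent state `s_t` of a history. -/
def History.last {n K : ℕ} : (t : ℕ) → History n K t → Fin K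
  | 0, h => h.1
  | t + 1, h => (h.2 (Fin.last t)).2.2

/-- Append the record `(x_{t+1}, y_{t+1}, s_{t+1})` to a history. -/
def History.extend {n K t : ℕ} (p : (History n K t × Vec n) × (Vec n × Fin K)) :
    History n K (t + 1) :=
  (p.1.1.1, Fin.snoc (α := fun _ => Vec n × Vec n × Fin K) p.1.1.2 (p.1.2, p.2.1, p.2.2))

theorem History.measurable_last {n K : ℕ} (t : ℕ) :
    Measurable (History.last (n := n) (K := K) t) := by
  cases t with
  | zero => exact measurable_fst
  | succ t =>
    exact ((measurable_pi_apply (Fin.last t)).comp measurable_snd).snd.snd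

theorem History.measurable_extend {n K t : ℕ} :
    Measurable (History.extend (n := n) (K := K) (t := t)) := by
  refine Measurable.prodMk (by fun_prop) (measurable_pi_lambda _ fun i => ?_)
  refine Fin.lastCases ?_ (fun j => ?_) i
  · simp only [Fin.snoc_last]
    fun_prop
  · simp only [Fin.snoc_castSucc]
    exact (measurable_pi_apply j).comp (by fun_prop)

/-- A (possibly randomized) decision rule for every time: given the history up to time `t`, the law
of a vector in `ℝⁿ`. Deterministic rules are the Dirac kernels. -/
structure Rules (n K : ℕ) where
  rule : (t : ℕ) → Kernel (History n K t) (Vec n)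
  markov : ∀ t, IsMarkovKernel (rule t)

/-- A policy: `rule t` is the law of the input `x_{t+1}` given the history up to time `t`. -/
abbrev Policy (n K : ℕ) : Type := Rules n K

/-- A sequence of optimal-input estimates: `rule t` is the law of the estimate of the optimal
input at time `t + 1` given the history up to time `t`. -/
abbrev Estimator (n K : ℕ) : Type := Rules n K

instance {n K : ℕ} (μ : Rules n K) (t : ℕ) : IsMarkovKernel (μ.rule t) := μ.markov t

variable {n K : ℕ}

/-- The law of the history up to time `t` when the policy `μ` runs on the model `m` and `s_0` has
law `init`. -/
def law (m : Model n K) (init : ProbabilityMeasure (Fin K)) (μ : Policy n K) :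
    (t : ℕ) → Measure (History n K t)
  | 0 => (init : Measure (Fin K)).map fun s => (s, Fin.elim0)
  | t + 1 =>
    ((law m init μ t ⊗ₘ μ.rule t) ⊗ₘ
      (m.outcome.comap (fun p => (History.last t p.1, p.2))
        (((History.measurable_last t).comp measurable_fst).prodMk measurable_snd))).map
      History.extend

instance (m : Model n K) (init : ProbabilityMeasure (Fin K)) (μ : Policy n K) (t : ℕ) :
    IsProbabilityMeasure (law m init μ t) := by
  induction t with
  | zero => exact Measure.isProbabilityMeasure_map (by fun_prop)
  | succ t ih => exact Measure.isProbabilityMeasure_map History.measurable_extend.aemeasurable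

/-- Cumulative mean squared error `E ∑_{t=1}^T ‖z_t - x*_{s_{t-1}}‖²`, where the history is generated
by the policy `μ` and `z_t` has, given the history up to time `t - 1`, the law prescribed by `r`
(written as the sum over `t` of the expectations). -/
def cumMSE (m : Model n K) (init : ProbabilityMeasure (Fin K)) (μ : Policy n K) (r : Rules n K)
    (T : ℕ) : ℝ≥0∞ :=
  ∑ t ∈ Finset.range T, ∫⁻ h, ∫⁻ z,
    ENNReal.ofReal (‖z - optInput m.θ m.P (History.last t h)‖ ^ 2) ∂(r.rule t h) ∂(law m init μ t)

/-- The regret `E ∑_{t=1}^T (J(s_{t-1}, x_t) - J(s_{t-1}, x*_{s_{t-1}}))` of the policy `μ` on the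
model `m`. The differences are nonnegative by `Model.stageCost_optInput_le`, so the
expectation is taken in `[0, ∞]`. -/
def regret (m : Model n K) (init : ProbabilityMeasure (Fin K)) (μ : Policy n K) (T : ℕ) : ℝ≥0∞ :=
  ∑ t ∈ Finset.range T, ∫⁻ h, ∫⁻ x,
    ENNReal.ofReal (m.stageCost (History.last t h) x -
      m.stageCost (History.last t h) (optInput m.θ m.P (History.last t h)))
      ∂(μ.rule t h) ∂(law m init μ t)

/-- Worst-case cumulative estimation-MSE of the estimates `e` under the policy `μ`. -/
def worstEstimationMSE (Θ : Set (Param n K)) (Pi : Set (Vec n)) (σ : ℝ)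
    (init : ProbabilityMeasure (Fin K)) (μ : Policy n K) (e : Estimator n K) (T : ℕ) : ℝ≥0∞ :=
  ⨆ (m : Model n K) (_ : m.Admissible Θ Pi σ), cumMSE m init μ e T

/-- Worst-case cumulative input-MSE of the policy `μ`. -/
def worstInputMSE (Θ : Set (Param n K)) (Pi : Set (Vec n)) (σ : ℝ)
    (init : ProbabilityMeasure (Fin K)) (μ : Policy n K) (T : ℕ) : ℝ≥0∞ :=
  ⨆ (m : Model n K) (_ : m.Admissible Θ Pi σ), cumMSE m init μ μ T

/-- Worst-case regret of the policy `μ`. -/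
def worstRegret (Θ : Set (Param n K)) (Pi : Set (Vec n)) (σ : ℝ)
    (init : ProbabilityMeasure (Fin K)) (μ : Policy n K) (T : ℕ) : ℝ≥0∞ :=
  ⨆ (m : Model n K) (_ : m.Admissible Θ Pi σ), regret m init μ T

namespace Model

theorem stageCost_eq (m : Model n K)
    (hint : ∀ k, Integrable (fun w => w) (m.noise k : Measure (Vec n)))
    (hmean : ∀ k, ∫ w, w ∂(m.noise k : Measure (Vec n)) = 0) (i : Fin K) (x : Vec n) :
    m.stageCost i x = -∑ j, m.P i j * inner ℝ x ((m.θ j).1.toEuclideanLin x + (m.θ j).2) := by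
  have hm : ∀ j : Fin K, Measurable fun w : Vec n =>
      ((m.θ j).1.toEuclideanLin x + (m.θ j).2 + w, j) := fun j => by fun_prop
  have hI : ∀ j : Fin K, Integrable (fun w : Vec n =>
      -inner ℝ x ((m.θ j).1.toEuclideanLin x + (m.θ j).2 + w)) (m.noise j : Measure (Vec n)) :=
    fun j => (((integrable_const _).add (hint j)).const_inner x).neg
  have hs : StronglyMeasurable fun z : Vec n × Fin K => -inner ℝ x z.1 :=
    (by fun_prop : Measurable fun z : Vec n × Fin K => -inner ℝ x z.1).stronglyMeasurable
  have hmap : ∀ j : Fin K, Integrable (fun z : Vec n × Fin K => -inner ℝ x z.1)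
      ((m.noise j : Measure (Vec n)).map
        (fun w => ((m.θ j).1.toEuclideanLin x + (m.θ j).2 + w, j))) := fun j =>
    (integrable_map_measure hs.aestronglyMeasurable (hm j).aemeasurable).2 (hI j)
  rw [stageCost, outcome_apply, integral_finsetSum_measure
    fun j _ => (hmap j).smul_measure ENNReal.ofReal_ne_top, ← Finset.sum_neg_distrib]
  refine Finset.sum_congr rfl fun j _ => ?_
  have hadd : Integrable (fun w : Vec n => (m.θ j).1.toEuclideanLin x + (m.θ j).2 + w)
      (m.noise j : Measure (Vec n)) := (integrable_const _).add (hint j)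
  have h1 : ∫ w, inner ℝ x ((m.θ j).1.toEuclideanLin x + (m.θ j).2 + w)
      ∂(m.noise j : Measure (Vec n)) = inner ℝ x ((m.θ j).1.toEuclideanLin x + (m.θ j).2) := by
    rw [integral_inner hadd, integral_add (integrable_const _) (hint j), hmean j]
    simp
  rw [integral_smul_measure, integral_map (hm j).aemeasurable hs.aestronglyMeasurable,
    ENNReal.toReal_ofReal (m.P_nonneg i j), integral_neg, h1, smul_eq_mul, mul_neg]

/-- For negative definite `A_j` and centred noise, the optimal input minimizes the stage cost. -/
theorem stageCost_optInput_le (m : Model n K)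
    (hint : ∀ k, Integrable (fun w => w) (m.noise k : Measure (Vec n)))
    (hmean : ∀ k, ∫ w, w ∂(m.noise k : Measure (Vec n)) = 0)
    (hneg : ∀ k, NegDef (m.θ k).1) (i : Fin K) (x : Vec n) :
    m.stageCost i (optInput m.θ m.P i) ≤ m.stageCost i x := by
  rw [m.stageCost_eq hint hmean, m.stageCost_eq hint hmean, neg_le_neg_iff]
  set S := ∑ j, m.P i j • ((m.θ j).1 + (m.θ j).1.transpose) with hS
  set v := ∑ j, m.P i j • (m.θ j).2 with hv
  set z := optInput m.θ m.P i with hz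
  have hadj : ∀ (B : Matrix (Fin n) (Fin n) ℝ) (a c : Vec n),
      inner ℝ a (B.transpose.toEuclideanLin c) = inner ℝ c (B.toEuclideanLin a) := fun B a c => by
    have h := Matrix.toEuclideanLin_conjTranspose_eq_adjoint B
    rw [Matrix.conjTranspose_eq_transpose_of_trivial] at h
    rw [h, LinearMap.adjoint_inner_right, real_inner_comm]
  have hSapp : ∀ a c : Vec n, inner ℝ a (S.toEuclideanLin c) = ∑ j, m.P i j *
      (inner ℝ a ((m.θ j).1.toEuclideanLin c) + inner ℝ c ((m.θ j).1.toEuclideanLin a)) :=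
    fun a c => by
      simp only [hS, map_sum, map_smul, map_add, LinearMap.sum_apply, LinearMap.smul_apply,
        LinearMap.add_apply, inner_sum, inner_smul_right, inner_add_right, hadj]
  have hle : ∀ a : Vec n, ∀ j, m.P i j * inner ℝ a ((m.θ j).1.toEuclideanLin a) ≤ 0 :=
    fun a j => by
      refine mul_nonpos_of_nonneg_of_nonpos (m.P_nonneg i j) ?_
      by_cases ha : a = 0
      · simp [ha]
      · exact (hneg j a ha).le
  have hunit : IsUnit S := by
    rw [← Matrix.mulVec_injective_iff_isUnit]
    refine (injective_iff_map_eq_zero (Matrix.mulVecLin S)).2 fun a ha => ?_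
    by_contra hne
    have hne' : (WithLp.toLp 2 a : Vec n) ≠ 0 := fun h => hne (by simpa using h)
    have h0 : S.toEuclideanLin (WithLp.toLp 2 a) = 0 := by
      rw [Matrix.mulVecLin_apply] at ha
      simp [Matrix.toLpLin_toLp, ha]
    have h1 := hSapp (WithLp.toLp 2 a) (WithLp.toLp 2 a)
    rw [h0, inner_zero_right] at h1
    obtain ⟨j, hj⟩ : ∃ j, 0 < m.P i j := by
      by_contra! hcon
      have := Finset.sum_nonpos fun j (_ : j ∈ Finset.univ) => hcon j
      rw [m.P_sum i] at this
      linarith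
    have h2 : ∑ j, m.P i j * (inner ℝ (WithLp.toLp 2 a : Vec n)
        ((m.θ j).1.toEuclideanLin (WithLp.toLp 2 a)) + inner ℝ (WithLp.toLp 2 a : Vec n)
        ((m.θ j).1.toEuclideanLin (WithLp.toLp 2 a))) < 0 := by
      refine Finset.sum_neg' (fun k _ => ?_) ⟨j, Finset.mem_univ j, ?_⟩
      · have := hle (WithLp.toLp 2 a) k
        linarith
      · have := mul_neg_of_pos_of_neg hj (hneg j _ hne')
        linarith
    linarith
  have hfoc : S.toEuclideanLin z + v = 0 := by
    have hcomp : S.toEuclideanLin (S⁻¹.toEuclideanLin v) = v := by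
      have hmul : S * S⁻¹ = 1 := Matrix.mul_nonsing_inv S ((Matrix.isUnit_iff_isUnit_det S).1 hunit)
      ext k
      simp [Matrix.toLpLin_apply, Matrix.mulVec_mulVec, hmul]
    rw [hz, optInput, map_neg, ← hS, ← hv, hcomp, neg_add_cancel]
  have key : ∑ j, m.P i j * inner ℝ x ((m.θ j).1.toEuclideanLin x + (m.θ j).2) -
      ∑ j, m.P i j * inner ℝ z ((m.θ j).1.toEuclideanLin z + (m.θ j).2) =
      inner ℝ (x - z) (S.toEuclideanLin z + v) +
        ∑ j, m.P i j * inner ℝ (x - z) ((m.θ j).1.toEuclideanLin (x - z)) := by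
    rw [inner_add_right, hSapp, hv, inner_sum, ← Finset.sum_sub_distrib, ← Finset.sum_add_distrib,
      ← Finset.sum_add_distrib]
    refine Finset.sum_congr rfl fun j _ => ?_
    simp only [map_sub, inner_sub_left, inner_sub_right, inner_add_right, inner_smul_right]
    ring
  rw [hfoc, inner_zero_right, zero_add] at key
  have := Finset.sum_nonpos fun j (_ : j ∈ Finset.univ) => hle (x - z) j
  linarith

end Model

end

end MarkovJump

/-!
Le Cam's two-point method. Fix a model with Gaussian noise whose optimal input `z ≠ 0` is the same
after every state. Replacing `(A_j, b_j)` by `(A_j + δ u uᵀ, b_j - δ ⟪u, z⟫ u)` with `u = z / ‖z‖`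
moves the optimal input by at least `c δ`, but changes the mean output only by `δ ⟪u, x - z⟫ u`.
Hence the information about the perturbation that a policy collects is at most
`δ² / σ² * E ∑ ‖x_t - z‖²`, which its input-MSE `W` bounds. As long as `δ² W ≲ σ²` the two models
cannot be told apart, and every sequence of estimates incurs an error `≳ δ² T` on one of them. The
choice `δ² ∼ 1 / W` gives the bound on the product; taking the inputs themselves as estimates turns
it into `W² ≳ T`, and negative definiteness bounds the regret below by a multiple of `W`.
-/

namespace MarkovJump

open scoped NNReal

section Gaussian

theorem gaussianPDFReal_add_mean (m d : ℝ) (v : ℝ≥0) (x : ℝ) :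
    gaussianPDFReal (m + d) v x =
      gaussianPDFReal m v x * Real.exp ((x - m) * d / v - d ^ 2 / v / 2) := by
  rcases eq_or_ne v 0 with rfl | hv
  · simp
  have hv' : (v : ℝ) ≠ 0 := by exact_mod_cast hv
  rw [gaussianPDFReal, gaussianPDFReal, mul_assoc (_⁻¹), ← Real.exp_add]
  congr 2
  field_simp
  ring

theorem gaussianReal_add_mean (m d : ℝ) {v : ℝ≥0} (hv : v ≠ 0) :
    gaussianReal (m + d) v = (gaussianReal m v).withDensity
      fun x => ENNReal.ofReal (Real.exp ((x - m) * d / v - d ^ 2 / v / 2)) := by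
  rw [gaussianReal_of_var_ne_zero _ hv, gaussianReal_of_var_ne_zero _ hv,
    ← withDensity_mul _ (measurable_gaussianPDF m v) (by fun_prop)]
  congr 1 with x
  simp only [Pi.mul_apply, gaussianPDF_def, gaussianPDFReal_add_mean,
    ENNReal.ofReal_mul (gaussianPDFReal_nonneg m v x)]

theorem integral_sq_gaussianReal (v : ℝ≥0) : ∫ x, x ^ 2 ∂gaussianReal 0 v = v := by
  have h := variance_id_gaussianReal (μ := 0) (v := v)
  rw [variance_eq_integral measurable_id.aemeasurable] at h
  simpa using h

theorem lintegral_sq_gaussianReal (v : ℝ≥0) :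
    ∫⁻ x, ENNReal.ofReal (x ^ 2) ∂gaussianReal 0 v = v := by
  have hint : Integrable (fun x : ℝ => x ^ 2) (gaussianReal 0 v) :=
    (memLp_id_gaussianReal' 2 (by simp)).integrable_sq
  rw [← ofReal_integral_eq_lintegral_ofReal hint (ae_of_all _ fun x => sq_nonneg x),
    integral_sq_gaussianReal, ENNReal.ofReal_coe_nnreal]

end Gaussian

section SecondMoment

variable {Ω : Type*} [MeasurableSpace Ω] {ν : Measure Ω} [IsProbabilityMeasure ν]

theorem lintegral_ofReal_add_sq {X : Ω → ℝ} (hX : MemLp X 2 ν) (hmean : ∫ ω, X ω ∂ν = 0) (a : ℝ) :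
    ∫⁻ ω, ENNReal.ofReal ((a + X ω) ^ 2) ∂ν =
      ENNReal.ofReal (a ^ 2) + ∫⁻ ω, ENNReal.ofReal (X ω ^ 2) ∂ν := by
  have hX₁ : Integrable X ν := hX.integrable one_le_two
  have hlin : Integrable (fun ω => a ^ 2 + 2 * a * X ω) ν :=
    (integrable_const _).add (hX₁.const_mul _)
  have hexpand : ∀ ω, (a + X ω) ^ 2 = (a ^ 2 + 2 * a * X ω) + X ω ^ 2 := fun ω => by ring
  have hsum : Integrable (fun ω => (a + X ω) ^ 2) ν := by
    simp only [hexpand]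
    exact hlin.add hX.integrable_sq
  rw [← ofReal_integral_eq_lintegral_ofReal hsum (.of_forall fun ω => sq_nonneg _),
    ← ofReal_integral_eq_lintegral_ofReal hX.integrable_sq (.of_forall fun ω => sq_nonneg _),
    ← ENNReal.ofReal_add (sq_nonneg a) (integral_nonneg fun ω => sq_nonneg (X ω))]
  simp only [hexpand]
  rw [integral_add hlin hX.integrable_sq, integral_add (integrable_const _) (hX₁.const_mul _),
    integral_const_mul, hmean]
  simp

theorem ofReal_sq_norm_sub_div_two_le_lintegral {E : Type*} [NormedAddCommGroup E]
    [MeasurableSpace E] [OpensMeasurableSpace E] (ρ : Measure E) [IsProbabilityMeasure ρ]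
    (x z : E) :
    ENNReal.ofReal (‖z - x‖ ^ 2 / 2) ≤
      ∫⁻ y, ENNReal.ofReal (‖y - z‖ ^ 2) ∂ρ + ∫⁻ y, ENNReal.ofReal (‖y - x‖ ^ 2) ∂ρ := by
  have hpoint : ∀ y : E, ‖z - x‖ ^ 2 / 2 ≤ ‖y - z‖ ^ 2 + ‖y - x‖ ^ 2 := fun y => by
    have htri : ‖z - x‖ ≤ ‖y - z‖ + ‖y - x‖ := by
      simpa only [norm_sub_rev y z] using norm_sub_le_norm_sub_add_norm_sub z y x
    nlinarith [sq_nonneg (‖y - z‖ - ‖y - x‖), norm_nonneg (z - x)]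
  have hmeas : Measurable fun y : E => ENNReal.ofReal (‖y - x‖ ^ 2) :=
    (by fun_prop : Continuous fun y : E => ‖y - x‖ ^ 2).measurable.ennreal_ofReal
  rw [← lintegral_add_right _ hmeas]
  calc ENNReal.ofReal (‖z - x‖ ^ 2 / 2) = ∫⁻ _, ENNReal.ofReal (‖z - x‖ ^ 2 / 2) ∂ρ := by simp
    _ ≤ _ := lintegral_mono fun y =>
      (ENNReal.ofReal_le_ofReal (hpoint y)).trans ENNReal.ofReal_add_le

end SecondMoment

section LeCam

variable {Ω : Type*} [MeasurableSpace Ω] {ν : Measure Ω}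

theorem mul_lintegral_min_one_le {f g L : Ω → ℝ≥0∞} {c : ℝ≥0∞} (hf : Measurable f)
    (hg : Measurable g) (hL : Measurable L) (hfg : ∀ ω, c ≤ f ω + g ω) :
    c * ∫⁻ ω, min 1 (L ω) ∂ν ≤ ∫⁻ ω, f ω ∂ν + ∫⁻ ω, g ω ∂ν.withDensity L := by
  rw [lintegral_withDensity_eq_lintegral_mul _ hL hg, ← lintegral_add_left hf,
    ← lintegral_const_mul _ (by fun_prop)]
  refine lintegral_mono fun ω => ?_
  calc c * min 1 (L ω) ≤ f ω * min 1 (L ω) + g ω * min 1 (L ω) := by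
        rw [← add_mul]
        exact mul_le_mul_left (hfg ω) _
    _ ≤ f ω * 1 + g ω * L ω := by
        gcongr
        · exact min_le_left _ _
        · exact min_le_right _ _
    _ = f ω + (L * g) ω := by rw [mul_one, mul_comm, Pi.mul_apply]

theorem three_quarters_le_min_one_exp_add (a : ℝ) {b : ℝ} (hb : 0 ≤ b) :
    3 / 4 ≤ min 1 (Real.exp (a - b / 2)) + (a ^ 2 + b / 2) := by
  rcases min_choice 1 (Real.exp (a - b / 2)) with h | h <;> rw [h]
  · nlinarith
  · nlinarith [Real.add_one_le_exp (a - b / 2), sq_nonneg (a + 1 / 2)]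

theorem three_eighths_le_lintegral_min_one_exp [IsProbabilityMeasure ν] {M V : Ω → ℝ}
    (hM : Measurable M) (hV : Measurable V) (hV₀ : ∀ ω, 0 ≤ V ω)
    (hMV : ∫⁻ ω, ENNReal.ofReal (M ω ^ 2) ∂ν ≤ ∫⁻ ω, ENNReal.ofReal (V ω) ∂ν)
    (hV₁ : ∫⁻ ω, ENNReal.ofReal (V ω) ∂ν ≤ ENNReal.ofReal (1 / 4)) :
    ENNReal.ofReal (3 / 8) ≤
      ∫⁻ ω, min 1 (ENNReal.ofReal (Real.exp (M ω - V ω / 2))) ∂ν := by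
  have hhalf : ∫⁻ ω, ENNReal.ofReal (V ω / 2) ∂ν ≤ ENNReal.ofReal (1 / 8) := by
    calc ∫⁻ ω, ENNReal.ofReal (V ω / 2) ∂ν = (∫⁻ ω, ENNReal.ofReal (V ω) ∂ν) / 2 := by
          simp_rw [ENNReal.ofReal_div_of_pos two_pos, div_eq_mul_inv]
          rw [lintegral_mul_const _ (by fun_prop)]
          simp
      _ ≤ ENNReal.ofReal (1 / 4) / ENNReal.ofReal 2 := by
          rw [ENNReal.ofReal_ofNat]
          gcongr
      _ = ENNReal.ofReal (1 / 8) := by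
          rw [← ENNReal.ofReal_div_of_pos two_pos]
          norm_num
  have hpoint : ∀ ω, ENNReal.ofReal (3 / 4) ≤
      min 1 (ENNReal.ofReal (Real.exp (M ω - V ω / 2))) +
        (ENNReal.ofReal (M ω ^ 2) + ENNReal.ofReal (V ω / 2)) := fun ω => by
    have hVω : 0 ≤ V ω / 2 := div_nonneg (hV₀ ω) zero_le_two
    rw [← ENNReal.ofReal_one, ← ENNReal.ofReal_min, ← ENNReal.ofReal_add (sq_nonneg _) hVω,
      ← ENNReal.ofReal_add (by positivity) (by positivity)]
    exact ENNReal.ofReal_le_ofReal (three_quarters_le_min_one_exp_add (M ω) (hV₀ ω))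
  refine ENNReal.le_of_add_le_add_right (a := ENNReal.ofReal (3 / 8)) ENNReal.ofReal_ne_top ?_
  calc ENNReal.ofReal (3 / 8) + ENNReal.ofReal (3 / 8)
      = ∫⁻ _, ENNReal.ofReal (3 / 4) ∂ν := by
        rw [← ENNReal.ofReal_add (by norm_num) (by norm_num)]
        norm_num
    _ ≤ ∫⁻ ω, min 1 (ENNReal.ofReal (Real.exp (M ω - V ω / 2))) ∂ν +
        (∫⁻ ω, ENNReal.ofReal (M ω ^ 2) ∂ν + ∫⁻ ω, ENNReal.ofReal (V ω / 2) ∂ν) := by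
        rw [← lintegral_add_left (by fun_prop), ← lintegral_add_left (by fun_prop)]
        exact lintegral_mono hpoint
    _ ≤ _ := by
        gcongr
        calc _ ≤ ENNReal.ofReal (1 / 4) + ENNReal.ofReal (1 / 8) :=
              add_le_add (hMV.trans hV₁) hhalf
          _ = ENNReal.ofReal (3 / 8) := by
              rw [← ENNReal.ofReal_add (by norm_num) (by norm_num)]
              norm_num

end LeCam

section LawOfHistory

variable {n K : ℕ} {m m' : Model n K}

theorem History.sum_extend {M : Type*} [AddCommMonoid M] (φ : Vec n × Vec n × Fin K → M) {t : ℕ}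
    (h : History n K t) (x : Vec n) (r : Vec n × Fin K) :
    ∑ i, φ ((History.extend ((h, x), r)).2 i) = ∑ i, φ (h.2 i) + φ (x, r) := by
  simp [History.extend, Fin.sum_univ_castSucc]

theorem History.prod_extend {M : Type*} [CommMonoid M] (φ : Vec n × Vec n × Fin K → M) {t : ℕ}
    (h : History n K t) (x : Vec n) (r : Vec n × Fin K) :
    ∏ i, φ ((History.extend ((h, x), r)).2 i) = (∏ i, φ (h.2 i)) * φ (x, r) := by
  simp [History.extend, Fin.prod_univ_castSucc]

theorem lintegral_law_succ (m : Model n K) (init : ProbabilityMeasure (Fin K)) (μ : Policy n K)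
    (t : ℕ) {F : History n K (t + 1) → ℝ≥0∞} (hF : Measurable F) :
    ∫⁻ h, F h ∂law m init μ (t + 1) =
      ∫⁻ h, ∫⁻ x, ∫⁻ r, F (History.extend ((h, x), r)) ∂m.outcome (History.last t h, x)
        ∂μ.rule t h ∂law m init μ t := by
  have hG := hF.comp (History.measurable_extend (n := n) (K := K) (t := t))
  rw [law, lintegral_map hF History.measurable_extend,
    Measure.lintegral_compProd (f := fun p => F (History.extend p)) hG,
    Measure.lintegral_compProd]
  · rfl
  · exact hG.lintegral_kernel_prod_right'

theorem measurable_lintegral_outcome (m : Model n K) (t : ℕ)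
    {G : (History n K t × Vec n) × (Vec n × Fin K) → ℝ≥0∞} (hG : Measurable G) :
    Measurable fun p : History n K t × Vec n =>
      ∫⁻ r, G (p, r) ∂m.outcome (History.last t p.1, p.2) :=
  hG.lintegral_kernel_prod_right' (κ := m.outcome.comap
    (fun p : History n K t × Vec n => (History.last t p.1, p.2))
    (((History.measurable_last t).comp measurable_fst).prodMk measurable_snd))

theorem measurable_lintegral_rule (r : Rules n K) (t : ℕ) {φ : Fin K → Vec n → ℝ≥0∞}
    (hφ : ∀ i, Measurable (φ i)) :
    Measurable fun h : History n K t => ∫⁻ y, φ (History.last t h) y ∂r.rule t h := by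
  have hφ' : Measurable (Function.uncurry φ) := measurable_from_prod_countable_right hφ
  exact Measurable.lintegral_kernel_prod_right'
    (hφ'.comp (((History.measurable_last t).comp measurable_fst).prodMk measurable_snd))

theorem law_eq_withDensity_prod {ℓ : Vec n × Vec n × Fin K → ℝ≥0∞} (hℓ : Measurable ℓ)
    (hdens : ∀ i x, m'.outcome (i, x) = (m.outcome (i, x)).withDensity fun r => ℓ (x, r))
    (init : ProbabilityMeasure (Fin K)) (μ : Policy n K) (t : ℕ) :
    law m' init μ t = (law m init μ t).withDensity fun h => ∏ i, ℓ (h.2 i) := by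
  induction t with
  | zero => simp [law, ← Pi.one_def]
  | succ t ih =>
    refine Measure.ext_of_lintegral _ fun F hF => ?_
    have hext := History.measurable_extend (n := n) (K := K) (t := t)
    have hstep : ∀ (h : History n K t) (x : Vec n),
        ∫⁻ r, F (History.extend ((h, x), r)) ∂m'.outcome (History.last t h, x) =
          ∫⁻ r, ℓ (x, r) * F (History.extend ((h, x), r)) ∂m.outcome (History.last t h, x) :=
      fun h x => by
        rw [hdens, lintegral_withDensity_eq_lintegral_mul _ (by fun_prop) (by fun_prop)]
        rfl
    have hinner := measurable_lintegral_outcome m t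
      (G := fun p => ℓ (p.1.2, p.2) * F (History.extend p)) (by fun_prop)
    rw [lintegral_law_succ m' init μ t hF, ih]
    simp only [hstep]
    rw [lintegral_withDensity_eq_lintegral_mul _ (by fun_prop) hinner.lintegral_kernel_prod_right',
      lintegral_withDensity_eq_lintegral_mul _ (by fun_prop) hF,
      lintegral_law_succ m init μ t (by fun_prop)]
    refine lintegral_congr fun h => ?_
    refine (lintegral_const_mul _ (hinner.comp measurable_prodMk_left)).symm.trans
      (lintegral_congr fun x => ?_)
    refine (lintegral_const_mul _ (by fun_prop)).symm.trans (lintegral_congr fun r => ?_)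
    simp only [Pi.mul_apply, History.prod_extend, mul_assoc]

theorem lintegral_sum_input_law (m : Model n K) (init : ProbabilityMeasure (Fin K))
    (μ : Policy n K) {φ : Vec n → ℝ≥0∞} (hφ : Measurable φ) (T : ℕ) :
    ∫⁻ h, ∑ i, φ (h.2 i).1 ∂law m init μ T =
      ∑ t ∈ Finset.range T, ∫⁻ h, ∫⁻ x, φ x ∂μ.rule t h ∂law m init μ t := by
  induction T with
  | zero => simp
  | succ T ih =>
    rw [lintegral_law_succ _ _ _ _ (by fun_prop), Finset.sum_range_succ, ← ih,
      ← lintegral_add_left (by fun_prop)]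
    refine lintegral_congr fun h => ?_
    simp only [History.sum_extend fun r => φ r.1, lintegral_const, measure_univ, mul_one]
    rw [lintegral_add_left measurable_const, lintegral_const, measure_univ, mul_one]

end LawOfHistory

section LikelihoodRatio

variable {n K : ℕ}

/-- The conditional law of `(y_t, s_t)` given `s_{t-1} = i` and `x_t = x` under `m'` has
log-likelihood ratio `ψ (x, y_t, s_t) - q x / 2` with respect to the one under `m`, where under `m`
the random variable `ψ (x, ·)` is centred with second moment `q x`. This is the shape of the
likelihood ratio of two Gaussian models that differ in their means; along a history, the `ψ` are the
increments of a martingale and `q` those of its predictable quadratic variation. -/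
structure HasLogLikelihoodRatio (m m' : Model n K) (ψ : Vec n × Vec n × Fin K → ℝ)
    (q : Vec n → ℝ) : Prop where
  measurable : Measurable ψ
  measurable_quadVar : Measurable q
  quadVar_nonneg : ∀ x, 0 ≤ q x
  outcome_eq : ∀ i x, m'.outcome (i, x) =
    (m.outcome (i, x)).withDensity fun r => ENNReal.ofReal (Real.exp (ψ (x, r) - q x / 2))
  memLp : ∀ i x, MemLp (fun r => ψ (x, r)) 2 (m.outcome (i, x))
  integral_eq_zero : ∀ i x, ∫ r, ψ (x, r) ∂m.outcome (i, x) = 0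
  lintegral_sq : ∀ i x, ∫⁻ r, ENNReal.ofReal (ψ (x, r) ^ 2) ∂m.outcome (i, x) =
    ENNReal.ofReal (q x)

namespace HasLogLikelihoodRatio

variable {m m' : Model n K} {ψ : Vec n × Vec n × Fin K → ℝ} {q : Vec n → ℝ}

theorem law_eq_withDensity (H : HasLogLikelihoodRatio m m' ψ q)
    (init : ProbabilityMeasure (Fin K)) (μ : Policy n K) (t : ℕ) :
    law m' init μ t = (law m init μ t).withDensity fun h =>
      ENNReal.ofReal (Real.exp (∑ i, ψ (h.2 i) - (∑ i, q (h.2 i).1) / 2)) := by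
  have hψ := H.measurable
  have hq := H.measurable_quadVar
  rw [law_eq_withDensity_prod
    (ℓ := fun r => ENNReal.ofReal (Real.exp (ψ r - q r.1 / 2))) (by fun_prop) H.outcome_eq]
  congr 1 with h
  rw [← ENNReal.ofReal_prod_of_nonneg fun i _ => (Real.exp_pos _).le, ← Real.exp_sum,
    Finset.sum_sub_distrib, Finset.sum_div]

theorem lintegral_sq_sum (H : HasLogLikelihoodRatio m m' ψ q)
    (init : ProbabilityMeasure (Fin K)) (μ : Policy n K) (t : ℕ) :
    ∫⁻ h, ENNReal.ofReal ((∑ i, ψ (h.2 i)) ^ 2) ∂law m init μ t =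
      ∫⁻ h, ENNReal.ofReal (∑ i, q (h.2 i).1) ∂law m init μ t := by
  have hψ := H.measurable
  have hq := H.measurable_quadVar
  induction t with
  | zero => simp
  | succ t ih =>
    have hnonneg : ∀ h : History n K t, 0 ≤ ∑ i, q (h.2 i).1 :=
      fun h => Finset.sum_nonneg fun i _ => H.quadVar_nonneg _
    rw [lintegral_law_succ _ _ _ _ (by fun_prop), lintegral_law_succ _ _ _ _ (by fun_prop)]
    simp only [History.sum_extend ψ, History.sum_extend fun r => q r.1,
      lintegral_ofReal_add_sq (H.memLp _ _) (H.integral_eq_zero _ _), H.lintegral_sq,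
      ENNReal.ofReal_add (hnonneg _) (H.quadVar_nonneg _), lintegral_const, measure_univ, mul_one]
    simp only [lintegral_add_left measurable_const, lintegral_const, measure_univ, mul_one]
    rw [lintegral_add_left (by fun_prop), lintegral_add_left (by fun_prop), ih]

theorem mul_le_lintegral_add_lintegral (H : HasLogLikelihoodRatio m m' ψ q)
    (init : ProbabilityMeasure (Fin K)) (μ : Policy n K) (t : ℕ)
    (hinfo : ∫⁻ h, ENNReal.ofReal (∑ i, q (h.2 i).1) ∂law m init μ t ≤ ENNReal.ofReal (1 / 4))
    {f g : History n K t → ℝ≥0∞} (hf : Measurable f) (hg : Measurable g) {c : ℝ≥0∞}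
    (hfg : ∀ h, c ≤ f h + g h) :
    c * ENNReal.ofReal (3 / 8) ≤ ∫⁻ h, f h ∂law m init μ t + ∫⁻ h, g h ∂law m' init μ t := by
  have hψ := H.measurable
  have hq := H.measurable_quadVar
  rw [H.law_eq_withDensity]
  refine le_trans ?_ (mul_lintegral_min_one_le hf hg (by fun_prop) hfg)
  gcongr
  exact three_eighths_le_lintegral_min_one_exp (by fun_prop) (by fun_prop)
    (fun h => Finset.sum_nonneg fun i _ => H.quadVar_nonneg _) (H.lintegral_sq_sum init μ t).le
    hinfo

theorem lintegral_sum_quadVar_le (H : HasLogLikelihoodRatio m m' ψ q) {κ : ℝ} (hκ : 0 ≤ κ)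
    (hqκ : ∀ i x, q x ≤ κ * ‖x - optInput m.θ m.P i‖ ^ 2) (init : ProbabilityMeasure (Fin K))
    (μ : Policy n K) (T : ℕ) :
    ∫⁻ h, ENNReal.ofReal (∑ i, q (h.2 i).1) ∂law m init μ T ≤
      ENNReal.ofReal κ * cumMSE m init μ μ T := by
  have hq := H.measurable_quadVar
  simp only [ENNReal.ofReal_sum_of_nonneg fun _ _ => H.quadVar_nonneg _]
  rw [lintegral_sum_input_law m init μ (φ := fun x => ENNReal.ofReal (q x)) (by fun_prop)]
  simp only [cumMSE, Finset.mul_sum, ← lintegral_const_mul' _ _ ENNReal.ofReal_ne_top,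
    ← ENNReal.ofReal_mul hκ]
  gcongr
  exact hqκ _ _

theorem le_cumMSE_add_cumMSE (H : HasLogLikelihoodRatio m m' ψ q) {b : ℝ} (hb : 0 ≤ b)
    (hsep : ∀ i, b ≤ ‖optInput m.θ m.P i - optInput m'.θ m'.P i‖)
    (init : ProbabilityMeasure (Fin K)) (μ : Policy n K) (r : Rules n K) {T : ℕ}
    (hinfo : ∀ t < T,
      ∫⁻ h, ENNReal.ofReal (∑ i, q (h.2 i).1) ∂law m init μ t ≤ ENNReal.ofReal (1 / 4)) :
    ENNReal.ofReal (T * (3 / 16 * b ^ 2)) ≤ cumMSE m init μ r T + cumMSE m' init μ r T := by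
  have hmeas : ∀ (m : Model n K) (t : ℕ), Measurable fun h : History n K t =>
      ∫⁻ y, ENNReal.ofReal (‖y - optInput m.θ m.P (History.last t h)‖ ^ 2) ∂r.rule t h :=
    fun m t => measurable_lintegral_rule r t
      (φ := fun i y => ENNReal.ofReal (‖y - optInput m.θ m.P i‖ ^ 2)) fun i => by fun_prop
  have hpoint : ∀ (t : ℕ) (h : History n K t), ENNReal.ofReal (b ^ 2 / 2) ≤
      ∫⁻ y, ENNReal.ofReal (‖y - optInput m.θ m.P (History.last t h)‖ ^ 2) ∂r.rule t h +
        ∫⁻ y, ENNReal.ofReal (‖y - optInput m'.θ m'.P (History.last t h)‖ ^ 2) ∂r.rule t h :=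
    fun t h => le_trans (by gcongr; exact hsep _)
      (ofReal_sq_norm_sub_div_two_le_lintegral (r.rule t h) _ _)
  calc ENNReal.ofReal (T * (3 / 16 * b ^ 2))
      = ∑ _t ∈ Finset.range T, ENNReal.ofReal (b ^ 2 / 2) * ENNReal.ofReal (3 / 8) := by
        rw [Finset.sum_const, Finset.card_range, nsmul_eq_mul, ← ENNReal.ofReal_mul (by positivity),
          ← ENNReal.ofReal_natCast, ← ENNReal.ofReal_mul (by positivity)]
        congr 1
        ring
    _ ≤ cumMSE m init μ r T + cumMSE m' init μ r T := by
        rw [cumMSE, cumMSE, ← Finset.sum_add_distrib]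
        exact Finset.sum_le_sum fun t ht => H.mul_le_lintegral_add_lintegral init μ t
          (hinfo t (Finset.mem_range.1 ht)) (hmeas m t) (hmeas m' t) (hpoint t)

end HasLogLikelihoodRatio

end LikelihoodRatio

section NegativeDefinite

variable {n : ℕ} {A B : Matrix (Fin n) (Fin n) ℝ}

theorem inner_transpose_toEuclideanLin (A : Matrix (Fin n) (Fin n) ℝ) (x y : Vec n) :
    inner ℝ x (A.transpose.toEuclideanLin y) = inner ℝ y (A.toEuclideanLin x) := by
  rw [← Matrix.conjTranspose_eq_transpose_of_trivial,
    Matrix.toEuclideanLin_conjTranspose_eq_adjoint, LinearMap.adjoint_inner_right, real_inner_comm]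

theorem NegDef.add_transpose (hA : NegDef A) : NegDef (A + A.transpose) := fun x hx => by
  rw [map_add, LinearMap.add_apply, inner_add_right, inner_transpose_toEuclideanLin]
  exact add_neg (hA x hx) (hA x hx)

theorem NegDef.isUnit (hA : NegDef A) : IsUnit A := by
  rw [← Matrix.mulVec_injective_iff_isUnit, ← Matrix.coe_mulVecLin, injective_iff_map_eq_zero]
  intro x hx
  by_contra hne
  have hneg := hA (WithLp.toLp 2 x) (by simpa using hne)
  rw [Matrix.mulVecLin_apply] at hx
  simp [Matrix.toLpLin_toLp, hx] at hneg

theorem toEuclideanLin_inv_apply (hA : IsUnit A) (x : Vec n) :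
    A.toEuclideanLin (A⁻¹.toEuclideanLin x) = x := by
  rw [← LinearMap.comp_apply, ← Matrix.toLpLin_mul_same,
    Matrix.mul_nonsing_inv A ((Matrix.isUnit_iff_isUnit_det A).1 hA), Matrix.toLpLin_one]
  rfl

theorem negDef_of_inner_le {c : ℝ} (hc : 0 < c)
    (hA : ∀ x : Vec n, inner ℝ x (A.toEuclideanLin x) ≤ -(c * ‖x‖ ^ 2)) : NegDef A := fun x hx =>
  (hA x).trans_lt (neg_neg_of_pos (mul_pos hc (pow_pos (norm_pos_iff.2 hx) 2)))

theorem exists_inner_le_of_isCompact {S : Set (Matrix (Fin n) (Fin n) ℝ)} (hS : IsCompact S)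
    (hneg : ∀ A ∈ S, NegDef A) :
    ∃ c : ℝ, 0 < c ∧
      ∀ A ∈ S, ∀ x : Vec n, inner ℝ x (A.toEuclideanLin x) ≤ -(c * ‖x‖ ^ 2) := by
  have hcont : Continuous fun p : Matrix (Fin n) (Fin n) ℝ × Vec n =>
      -inner ℝ p.2 (p.1.toEuclideanLin p.2) := by
    simp only [Matrix.toLpLin_apply]
    exact (continuous_snd.inner ((PiLp.continuous_toLp 2 _).comp
      (Continuous.matrix_mulVec (by fun_prop) (by fun_prop)))).neg
  have hpos : ∀ p ∈ S ×ˢ Metric.sphere (0 : Vec n) 1,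
      0 < -inner ℝ p.2 (p.1.toEuclideanLin p.2) := fun p hp =>
    neg_pos.2 (hneg p.1 hp.1 p.2 (ne_zero_of_mem_unit_sphere ⟨p.2, hp.2⟩))
  obtain ⟨c, hc, hle⟩ := (hS.prod (isCompact_sphere 0 1)).exists_forall_le'
    hcont.continuousOn hpos
  refine ⟨c, hc, fun A hA x => ?_⟩
  rcases eq_or_ne x 0 with rfl | hx
  · simp
  have hx₀ : ‖x‖ ≠ 0 := norm_ne_zero_iff.2 hx
  have hunit := hle (A, ‖x‖⁻¹ • x) ⟨hA, by simp [norm_smul, hx₀]⟩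
  simp only [map_smul, inner_smul_left, inner_smul_right, conj_trivial] at hunit
  calc inner ℝ x (A.toEuclideanLin x)
      = -(-(‖x‖⁻¹ * (‖x‖⁻¹ * inner ℝ x (A.toEuclideanLin x))) * ‖x‖ ^ 2) := by field
    _ ≤ -(c * ‖x‖ ^ 2) := by gcongr

end NegativeDefinite

section OptimalInput

variable {n K : ℕ} {θ : Param n K} {P : Matrix (Fin K) (Fin K) ℝ}

/-- The slope `∑_j p_{ij} A_j` of the mean output after the previous state `i`. -/
noncomputable def meanMatrix (θ : Param n K) (P : Matrix (Fin K) (Fin K) ℝ) (i : Fin K) :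
    Matrix (Fin n) (Fin n) ℝ :=
  ∑ j, P i j • (θ j).1

/-- The offset `∑_j p_{ij} b_j` of the mean output after the previous state `i`. -/
noncomputable def meanOffset (θ : Param n K) (P : Matrix (Fin K) (Fin K) ℝ) (i : Fin K) : Vec n :=
  ∑ j, P i j • (θ j).2

theorem inner_meanMatrix_mem (hP : P ∈ Matrix.rowStochastic ℝ (Fin K)) {s : Set ℝ}
    (hs : Convex ℝ s) {x : Vec n} (hx : ∀ j, inner ℝ x ((θ j).1.toEuclideanLin x) ∈ s)
    (i : Fin K) : inner ℝ x ((meanMatrix θ P i).toEuclideanLin x) ∈ s := by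
  simp only [meanMatrix, map_sum, map_smul, LinearMap.sum_apply, LinearMap.smul_apply, inner_sum,
    inner_smul_right]
  exact hs.sum_mem (fun j _ => Matrix.nonneg_of_mem_rowStochastic hP)
    (Matrix.sum_row_of_mem_rowStochastic hP i) fun j _ => hx j

theorem negDef_meanMatrix (hneg : ∀ k, NegDef (θ k).1) (hP : P ∈ Matrix.rowStochastic ℝ (Fin K))
    (i : Fin K) : NegDef (meanMatrix θ P i) := fun x hx =>
  inner_meanMatrix_mem hP (convex_Iio 0) (fun j => hneg j x hx) i

theorem optInput_eq (θ : Param n K) (P : Matrix (Fin K) (Fin K) ℝ) (i : Fin K) :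
    optInput θ P i = -((meanMatrix θ P i + (meanMatrix θ P i).transpose)⁻¹.toEuclideanLin
      (meanOffset θ P i)) := by
  simp only [optInput, meanMatrix, meanOffset, smul_add, Finset.sum_add_distrib,
    Matrix.transpose_sum, Matrix.transpose_smul]

theorem toEuclideanLin_optInput_add_meanOffset {i : Fin K} (h : NegDef (meanMatrix θ P i)) :
    (meanMatrix θ P i + (meanMatrix θ P i).transpose).toEuclideanLin (optInput θ P i) +
      meanOffset θ P i = 0 := by
  rw [optInput_eq, map_neg, toEuclideanLin_inv_apply h.add_transpose.isUnit, neg_add_cancel]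

theorem inner_affine_sub_inner_affine (A : Matrix (Fin n) (Fin n) ℝ) (b x z : Vec n) :
    inner ℝ x (A.toEuclideanLin x + b) - inner ℝ z (A.toEuclideanLin z + b) =
      inner ℝ (x - z) ((A + A.transpose).toEuclideanLin z + b) +
        inner ℝ (x - z) (A.toEuclideanLin (x - z)) := by
  simp only [map_add, map_sub, LinearMap.add_apply, inner_add_right, inner_sub_left,
    inner_sub_right, inner_transpose_toEuclideanLin]
  ring

namespace Model

variable {m : Model n K}

theorem stageCost_eq_neg_inner (hint : ∀ k, Integrable (fun w => w) (m.noise k : Measure (Vec n)))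
    (hmean : ∀ k, ∫ w, w ∂(m.noise k : Measure (Vec n)) = 0) (i : Fin K) (x : Vec n) :
    m.stageCost i x =
      -inner ℝ x ((meanMatrix m.θ m.P i).toEuclideanLin x + meanOffset m.θ m.P i) := by
  rw [m.stageCost_eq hint hmean]
  simp only [meanMatrix, meanOffset, map_sum, map_smul, LinearMap.sum_apply, LinearMap.smul_apply,
    ← Finset.sum_add_distrib, ← smul_add, inner_sum, inner_smul_right]

theorem stageCost_sub_stageCost_optInput
    (hint : ∀ k, Integrable (fun w => w) (m.noise k : Measure (Vec n)))
    (hmean : ∀ k, ∫ w, w ∂(m.noise k : Measure (Vec n)) = 0) {i : Fin K}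
    (hneg : NegDef (meanMatrix m.θ m.P i)) (x : Vec n) :
    m.stageCost i x - m.stageCost i (optInput m.θ m.P i) =
      -inner ℝ (x - optInput m.θ m.P i)
        ((meanMatrix m.θ m.P i).toEuclideanLin (x - optInput m.θ m.P i)) := by
  rw [stageCost_eq_neg_inner hint hmean, stageCost_eq_neg_inner hint hmean, neg_sub_neg,
    ← neg_sub, inner_affine_sub_inner_affine, toEuclideanLin_optInput_add_meanOffset hneg,
    inner_zero_right, zero_add]

theorem mul_cumMSE_le_regret (hint : ∀ k, Integrable (fun w => w) (m.noise k : Measure (Vec n)))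
    (hmean : ∀ k, ∫ w, w ∂(m.noise k : Measure (Vec n)) = 0) {c : ℝ} (hc : 0 < c)
    (hcoer : ∀ k, ∀ x : Vec n, inner ℝ x ((m.θ k).1.toEuclideanLin x) ≤ -(c * ‖x‖ ^ 2))
    (init : ProbabilityMeasure (Fin K)) (μ : Policy n K) (T : ℕ) :
    ENNReal.ofReal c * cumMSE m init μ μ T ≤ regret m init μ T := by
  have hmean_coer : ∀ (i : Fin K) (x : Vec n),
      inner ℝ x ((meanMatrix m.θ m.P i).toEuclideanLin x) ≤ -(c * ‖x‖ ^ 2) := fun i x =>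
    inner_meanMatrix_mem m.stochastic (convex_Iic _) (fun j => hcoer j x) i
  have hstep : ∀ (i : Fin K) (x : Vec n), ENNReal.ofReal c *
      ENNReal.ofReal (‖x - optInput m.θ m.P i‖ ^ 2) ≤
        ENNReal.ofReal (m.stageCost i x - m.stageCost i (optInput m.θ m.P i)) := fun i x => by
    rw [← ENNReal.ofReal_mul hc.le, stageCost_sub_stageCost_optInput hint hmean
      (negDef_of_inner_le hc (hmean_coer i))]
    exact ENNReal.ofReal_le_ofReal (le_neg_of_le_neg (hmean_coer i _))
  simp only [cumMSE, regret, Finset.mul_sum, ← lintegral_const_mul' _ _ ENNReal.ofReal_ne_top]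
  gcongr
  exact hstep _ _

end Model

end OptimalInput

section GaussianModel

variable {n K : ℕ} {P : Matrix (Fin K) (Fin K) ℝ}

/-- Gaussian noise of variance `v` along the line spanned by `u`, and no noise orthogonally
to it. -/
noncomputable def lineNoise (u : Vec n) (v : ℝ≥0) : ProbabilityMeasure (Vec n) :=
  ⟨(gaussianReal 0 v).map fun g => g • u, Measure.isProbabilityMeasure_map (by fun_prop)⟩

theorem coe_lineNoise (u : Vec n) (v : ℝ≥0) :
    (lineNoise u v : Measure (Vec n)) = (gaussianReal 0 v).map fun g => g • u := rfl

/-- The model with noise `lineNoise u v` in every state. -/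
noncomputable def gaussianModel (θ : Param n K) (hP : P ∈ Matrix.rowStochastic ℝ (Fin K))
    (u : Vec n) (v : ℝ≥0) : Model n K where
  θ := θ
  P := P
  stochastic := hP
  noise _ := lineNoise u v

theorem gaussianModel_admissible {θ : Param n K} (hP : P ∈ Matrix.rowStochastic ℝ (Fin K))
    {u : Vec n} (hu : ‖u‖ ≤ 1) {v : ℝ≥0} {Θ : Set (Param n K)} {Pi : Set (Vec n)} {σ : ℝ}
    (hv : (v : ℝ) ≤ σ ^ 2) (hθ : θ ∈ Θ) (hopt : ∀ i, optInput θ P i ∈ Pi) :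
    (gaussianModel θ hP u v).Admissible Θ Pi σ where
  mem := hθ
  opt_mem := hopt
  memLp _ := by
    simp only [gaussianModel, coe_lineNoise]
    rw [memLp_map_measure_iff (by fun_prop) (by fun_prop)]
    exact (ContinuousLinearMap.toSpanSingleton ℝ u).comp_memLp' (memLp_id_gaussianReal' 2 (by simp))
  mean_zero _ := by
    simp only [gaussianModel, coe_lineNoise]
    rw [integral_map (by fun_prop) (by fun_prop), integral_smul_const, integral_id_gaussianReal,
      zero_smul]
  second_moment _ i := by
    have hui : u i ^ 2 ≤ 1 := (sq_le_one_iff_abs_le_one _).2 ((PiLp.norm_apply_le u i).trans hu)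
    simp only [gaussianModel, coe_lineNoise]
    rw [integral_map (by fun_prop) (by fun_prop)]
    simp only [PiLp.smul_apply, smul_eq_mul, mul_pow]
    rw [integral_mul_const, integral_sq_gaussianReal]
    exact (mul_le_of_le_one_right v.2 hui).trans hv

theorem lintegral_gaussianModel_outcome (θ : Param n K) (hP : P ∈ Matrix.rowStochastic ℝ (Fin K))
    (u : Vec n) (v : ℝ≥0) (i : Fin K) (x : Vec n) {F : Vec n × Fin K → ℝ≥0∞} (hF : Measurable F) :
    ∫⁻ r, F r ∂(gaussianModel θ hP u v).outcome (i, x) =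
      ∑ j, ENNReal.ofReal (P i j) *
        ∫⁻ g, F ((θ j).1.toEuclideanLin x + (θ j).2 + g • u, j) ∂gaussianReal 0 v := by
  rw [Model.outcome_apply, lintegral_finsetSum_measure]
  refine Finset.sum_congr rfl fun j _ => ?_
  simp only [gaussianModel, coe_lineNoise]
  rw [lintegral_smul_measure, lintegral_map hF (by fun_prop),
    lintegral_map (by fun_prop) (by fun_prop), smul_eq_mul]

/-- The deviation of the output, in the direction `u`, from its mean under `θ`, as a function of
the record `(x, y, s)` of one time step. -/
noncomputable def residual (θ : Param n K) (u : Vec n) (r : Vec n × Vec n × Fin K) : ℝ :=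
  inner ℝ u (r.2.1 - ((θ r.2.2).1.toEuclideanLin r.1 + (θ r.2.2).2))

theorem measurable_residual (θ : Param n K) (u : Vec n) : Measurable (residual θ u) := by
  have hslice : Measurable fun r : (Vec n × Vec n) × Fin K =>
      inner ℝ u (r.1.2 - ((θ r.2).1.toEuclideanLin r.1.1 + (θ r.2).2)) := by
    refine measurable_from_prod_countable_left fun j => ?_
    have hlin : Measurable fun x : Vec n => (θ j).1.toEuclideanLin x :=
      (LinearMap.continuous_of_finiteDimensional _).measurable
    dsimp only
    fun_prop
  exact hslice.comp (f := fun r : Vec n × Vec n × Fin K => ((r.1, r.2.1), r.2.2)) (by fun_prop)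

theorem residual_mean_add_smul (θ : Param n K) {u : Vec n} (hu : ‖u‖ = 1) (x : Vec n) (g : ℝ)
    (j : Fin K) :
    residual θ u (x, (θ j).1.toEuclideanLin x + (θ j).2 + g • u, j) = g := by
  simp [residual, inner_smul_right, hu]

theorem map_residual_gaussianModel_outcome (θ : Param n K)
    (hP : P ∈ Matrix.rowStochastic ℝ (Fin K)) {u : Vec n} (hu : ‖u‖ = 1) (v : ℝ≥0) (i : Fin K)
    (x : Vec n) :
    ((gaussianModel θ hP u v).outcome (i, x)).map (fun r => residual θ u (x, r)) =
      gaussianReal 0 v := by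
  have hres := measurable_residual θ u
  refine Measure.ext_of_lintegral _ fun F hF => ?_
  rw [lintegral_map hF (by fun_prop), lintegral_gaussianModel_outcome θ hP u v i x (by fun_prop)]
  simp only [residual_mean_add_smul θ hu]
  rw [← Finset.sum_mul, ← ENNReal.ofReal_sum_of_nonneg
    fun j _ => Matrix.nonneg_of_mem_rowStochastic hP, Matrix.sum_row_of_mem_rowStochastic hP,
    ENNReal.ofReal_one, one_mul]

end GaussianModel

section Tilt

variable {n K : ℕ} {P : Matrix (Fin K) (Fin K) ℝ}

/-- The parameters `(A_j + δ u uᵀ, b_j - δ ⟪u, z⟫ u)`. They change the mean output at the input `x`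
by `δ ⟪u, x - z⟫ u`, hence not at all at `x = z`: a policy that plays inputs close to `z` cannot
tell them from `θ`. -/
noncomputable def tilt (θ : Param n K) (u z : Vec n) (δ : ℝ) : Param n K := fun j =>
  ((θ j).1 + δ • Matrix.vecMulVec u u, (θ j).2 - (δ * inner ℝ u z) • u)

theorem toEuclideanLin_vecMulVec (u x : Vec n) :
    (Matrix.vecMulVec u u).toEuclideanLin x = inner ℝ u x • u := by
  have h := InnerProductSpace.symm_toEuclideanLin_rankOne (𝕜 := ℝ) u u
  rw [LinearEquiv.symm_apply_eq, star_trivial] at h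
  rw [← h]
  rfl

theorem tilt_zero (θ : Param n K) (u z : Vec n) : tilt θ u z 0 = θ := by
  funext j
  ext1 <;> simp [tilt]

theorem continuous_tilt (θ : Param n K) (u z : Vec n) : Continuous (tilt θ u z) := by
  unfold tilt
  fun_prop

theorem tilt_apply_add (θ : Param n K) (u z : Vec n) (δ : ℝ) (j : Fin K) (x : Vec n) :
    (tilt θ u z δ j).1.toEuclideanLin x + (tilt θ u z δ j).2 =
      (θ j).1.toEuclideanLin x + (θ j).2 + (δ * inner ℝ u (x - z)) • u := by
  simp only [tilt, map_add, map_smul, LinearMap.add_apply, LinearMap.smul_apply,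
    toEuclideanLin_vecMulVec, inner_sub_right]
  module

theorem meanMatrix_tilt (θ : Param n K) (hP : P ∈ Matrix.rowStochastic ℝ (Fin K)) (u z : Vec n)
    (δ : ℝ) (i : Fin K) :
    meanMatrix (tilt θ u z δ) P i = meanMatrix θ P i + δ • Matrix.vecMulVec u u := by
  simp only [meanMatrix, tilt, smul_add, Finset.sum_add_distrib, ← Finset.sum_smul,
    Matrix.sum_row_of_mem_rowStochastic hP, one_smul]

theorem meanOffset_tilt (θ : Param n K) (hP : P ∈ Matrix.rowStochastic ℝ (Fin K)) (u z : Vec n)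
    (δ : ℝ) (i : Fin K) :
    meanOffset (tilt θ u z δ) P i = meanOffset θ P i - (δ * inner ℝ u z) • u := by
  simp only [meanOffset, tilt, smul_sub, Finset.sum_sub_distrib, ← Finset.sum_smul,
    Matrix.sum_row_of_mem_rowStochastic hP, one_smul]

theorem gaussianModel_tilt_outcome (θ : Param n K) (hP : P ∈ Matrix.rowStochastic ℝ (Fin K))
    {u : Vec n} (hu : ‖u‖ = 1) {v : ℝ≥0} (hv : v ≠ 0) (z : Vec n) (δ : ℝ) (i : Fin K) (x : Vec n) :
    (gaussianModel (tilt θ u z δ) hP u v).outcome (i, x) =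
      ((gaussianModel θ hP u v).outcome (i, x)).withDensity fun r =>
        ENNReal.ofReal (Real.exp (residual θ u (x, r) * (δ * inner ℝ u (x - z)) / v -
          (δ * inner ℝ u (x - z)) ^ 2 / v / 2)) := by
  have hres := measurable_residual θ u
  set d := δ * inner ℝ u (x - z)
  refine Measure.ext_of_lintegral _ fun F hF => ?_
  rw [lintegral_withDensity_eq_lintegral_mul _ (by fun_prop) hF,
    lintegral_gaussianModel_outcome _ hP u v i x hF,
    lintegral_gaussianModel_outcome θ hP u v i x (by fun_prop)]
  refine Finset.sum_congr rfl fun j _ => congrArg _ ?_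
  set y := (θ j).1.toEuclideanLin x + (θ j).2
  calc ∫⁻ g, F ((tilt θ u z δ j).1.toEuclideanLin x + (tilt θ u z δ j).2 + g • u, j)
        ∂gaussianReal 0 v
      = ∫⁻ g, F (y + (g + d) • u, j) ∂gaussianReal 0 v := by
        refine lintegral_congr fun g => ?_
        rw [tilt_apply_add, add_assoc, ← add_smul, add_comm d g]
    _ = ∫⁻ g, F (y + g • u, j) ∂gaussianReal (0 + d) v := by
        rw [← gaussianReal_map_add_const, lintegral_map (by fun_prop) (by fun_prop)]
    _ = _ := by
        rw [gaussianReal_add_mean 0 d hv,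
          lintegral_withDensity_eq_lintegral_mul _ (by fun_prop) (by fun_prop)]
        simp only [Pi.mul_apply, y, residual_mean_add_smul θ hu, sub_zero]

theorem hasLogLikelihoodRatio_tilt (θ : Param n K) (hP : P ∈ Matrix.rowStochastic ℝ (Fin K))
    {u : Vec n} (hu : ‖u‖ = 1) {v : ℝ≥0} (hv : v ≠ 0) (z : Vec n) (δ : ℝ) :
    HasLogLikelihoodRatio (gaussianModel θ hP u v) (gaussianModel (tilt θ u z δ) hP u v)
      (fun r => residual θ u r * (δ * inner ℝ u (r.1 - z)) / v)
      (fun x => (δ * inner ℝ u (x - z)) ^ 2 / v) := by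
  have hres := measurable_residual θ u
  have hmap := map_residual_gaussianModel_outcome θ hP hu v
  have hslice : ∀ x : Vec n, Measurable fun r => residual θ u (x, r) := fun x => by fun_prop
  refine ⟨by fun_prop, by fun_prop, fun x => by positivity,
    gaussianModel_tilt_outcome θ hP hu hv z δ, fun i x => ?_, fun i x => ?_, fun i x => ?_⟩
  · have hL2 : MemLp id 2 (((gaussianModel θ hP u v).outcome (i, x)).map
        fun r => residual θ u (x, r)) := hmap i x ▸ memLp_id_gaussianReal' 2 (by simp)
    simp only [mul_div_assoc]
    exact ((memLp_map_measure_iff (by fun_prop) (hslice x).aemeasurable).1 hL2).mul_const _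
  · have hmean := integral_id_gaussianReal (μ := 0) (v := v)
    rw [← hmap i x, integral_map (hslice x).aemeasurable (by fun_prop)] at hmean
    simp only [mul_div_assoc]
    rw [integral_mul_const, hmean, zero_mul]
  · have hvar := lintegral_sq_gaussianReal v
    rw [← hmap i x, lintegral_map (by fun_prop) (hslice x)] at hvar
    simp only [mul_div_assoc (residual _ _ _), mul_pow (residual _ _ _),
      ENNReal.ofReal_mul (sq_nonneg (residual _ _ _))]
    rw [lintegral_mul_const _ (by fun_prop), hvar, ← ENNReal.ofReal_coe_nnreal,
      ← ENNReal.ofReal_mul v.coe_nonneg]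
    congr 1
    field

end Tilt

section Separation

variable {n K : ℕ} {θ : Param n K} {P : Matrix (Fin K) (Fin K) ℝ} {i : Fin K}

theorem toEuclideanLin_optInput_tilt_sub (hP : P ∈ Matrix.rowStochastic ℝ (Fin K)) {u z : Vec n}
    {δ : ℝ} (hz : optInput θ P i = z) (hneg : NegDef (meanMatrix θ P i))
    (hnegδ : NegDef (meanMatrix (tilt θ u z δ) P i)) :
    (meanMatrix θ P i + (meanMatrix θ P i).transpose).toEuclideanLin
        (optInput (tilt θ u z δ) P i - z) +
      (2 * δ * inner ℝ u (optInput (tilt θ u z δ) P i - z)) • u = -((δ * inner ℝ u z) • u) := by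
  have hfoc := toEuclideanLin_optInput_add_meanOffset hneg
  have hfocδ := toEuclideanLin_optInput_add_meanOffset hnegδ
  rw [hz] at hfoc
  rw [meanMatrix_tilt θ hP, meanOffset_tilt θ hP] at hfocδ
  simp only [Matrix.transpose_add, Matrix.transpose_smul, Matrix.transpose_vecMulVec, map_add,
    map_smul, map_sub, LinearMap.add_apply, LinearMap.smul_apply, toEuclideanLin_vecMulVec,
    inner_sub_right] at hfoc hfocδ ⊢
  linear_combination (norm := module) hfocδ - hfoc

theorem exists_mul_abs_inner_le_mul_norm_sub_optInput_tilt
    (hP : P ∈ Matrix.rowStochastic ℝ (Fin K)) (hneg : NegDef (meanMatrix θ P i)) :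
    ∃ N : ℝ, 0 ≤ N ∧ ∀ (u : Vec n) (δ : ℝ), ‖u‖ = 1 → 0 ≤ δ →
      NegDef (meanMatrix (tilt θ u (optInput θ P i) δ) P i) →
        δ * |inner ℝ u (optInput θ P i)| ≤
          (N + 2 * δ) * ‖optInput θ P i - optInput (tilt θ u (optInput θ P i) δ) P i‖ := by
  set M := LinearMap.toContinuousLinearMap
    (meanMatrix θ P i + (meanMatrix θ P i).transpose).toEuclideanLin
  set z := optInput θ P i
  refine ⟨‖M‖, norm_nonneg M, fun u δ hu hδ hnegδ => ?_⟩
  set d := optInput (tilt θ u z δ) P i - z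
  have hfoc : M d + (2 * δ * inner ℝ u d) • u = -((δ * inner ℝ u z) • u) :=
    toEuclideanLin_optInput_tilt_sub hP rfl hneg hnegδ
  calc δ * |inner ℝ u z|
      = ‖M d + (2 * δ * inner ℝ u d) • u‖ := by
        rw [hfoc, norm_neg, norm_smul, hu, mul_one, norm_mul, Real.norm_of_nonneg hδ,
          Real.norm_eq_abs]
    _ ≤ ‖M d‖ + ‖(2 * δ * inner ℝ u d) • u‖ := norm_add_le _ _
    _ = ‖M d‖ + 2 * δ * ‖(inner ℝ u d : ℝ)‖ := by
        rw [norm_smul, hu, mul_one, norm_mul, Real.norm_of_nonneg (by positivity)]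
    _ ≤ ‖M‖ * ‖d‖ + 2 * δ * (‖u‖ * ‖d‖) := by
        gcongr
        · exact M.le_opNorm d
        · exact norm_inner_le_norm u d
    _ = (‖M‖ + 2 * δ) * ‖z - optInput (tilt θ u z δ) P i‖ := by
        rw [hu, norm_sub_rev z]
        ring

theorem exists_mem_optInput_ne_zero [NeZero n] (hP : P ∈ Matrix.rowStochastic ℝ (Fin K))
    {U : Set (Param n K)} (hU : IsOpen U) (hθ : θ ∈ U) (hneg : NegDef (meanMatrix θ P i)) :
    ∃ θ' ∈ U, optInput θ' P i ≠ 0 := by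
  by_contra! hzero
  set e : Vec n := EuclideanSpace.single 0 1
  set shift : ℝ → Param n K := fun τ j => ((θ j).1, (θ j).2 + τ • e)
  have hcont : Continuous shift := by fun_prop
  have hmem : ∀ᶠ τ in nhdsWithin 0 {0}ᶜ, shift τ ∈ U :=
    ((hU.preimage hcont).eventually_mem (by simpa [shift] using hθ)).filter_mono
      nhdsWithin_le_nhds
  obtain ⟨τ, hτU, hτ⟩ := (hmem.and self_mem_nhdsWithin).exists
  have hfoc := toEuclideanLin_optInput_add_meanOffset hneg
  have hfocτ := toEuclideanLin_optInput_add_meanOffset (θ := shift τ) (i := i) hneg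
  rw [hzero θ hθ, map_zero, zero_add] at hfoc
  rw [hzero _ hτU, map_zero, zero_add] at hfocτ
  have hoffset : meanOffset (shift τ) P i = meanOffset θ P i + τ • e := by
    simp only [meanOffset, shift, smul_add, Finset.sum_add_distrib, ← Finset.sum_smul,
      Matrix.sum_row_of_mem_rowStochastic hP, one_smul]
  rw [hfocτ, hfoc, zero_add, eq_comm, smul_eq_zero] at hoffset
  exact hoffset.elim hτ (by simp [e])

theorem uniformTransition_stochastic [NeZero K] :
    uniformTransition K ∈ Matrix.rowStochastic ℝ (Fin K) := by
  rw [Matrix.mem_rowStochastic]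
  refine ⟨fun i j => by simp [uniformTransition], ?_⟩
  ext i
  simp [uniformTransition, Matrix.mulVec, dotProduct, NeZero.ne K]

theorem exists_tilt_mem_separated [NeZero n] [NeZero K] {U : Set (Param n K)} (hU : IsOpen U)
    (hne : U.Nonempty) (hneg : ∀ θ ∈ U, ∀ k, NegDef (θ k).1) :
    ∃ (θ : Param n K) (u z : Vec n) (δ₀ c : ℝ), ‖u‖ = 1 ∧ 0 < δ₀ ∧ 0 < c ∧
      (∀ i, optInput θ (uniformTransition K) i = z) ∧
      ∀ δ ∈ Set.Icc 0 δ₀, tilt θ u z δ ∈ U ∧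
        ∀ i, c * δ ≤ ‖z - optInput (tilt θ u z δ) (uniformTransition K) i‖ := by
  have hP := uniformTransition_stochastic (K := K)
  have hnegP : ∀ θ ∈ U, NegDef (meanMatrix θ (uniformTransition K) 0) := fun θ hθ =>
    negDef_meanMatrix (hneg θ hθ) hP 0
  obtain ⟨θ, hθ, hz⟩ : ∃ θ ∈ U, optInput θ (uniformTransition K) 0 ≠ 0 :=
    exists_mem_optInput_ne_zero hP hU hne.some_mem (hnegP _ hne.some_mem)
  obtain ⟨N, hN, hle⟩ :=
    exists_mul_abs_inner_le_mul_norm_sub_optInput_tilt hP (hnegP θ hθ)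
  set z := optInput θ (uniformTransition K) 0
  set u := ‖z‖⁻¹ • z
  have hu : ‖u‖ = 1 := norm_smul_inv_norm (𝕜 := ℝ) hz
  have huz : inner ℝ u z = ‖z‖ := by
    rw [real_inner_smul_left, real_inner_self_eq_norm_sq]
    field
  have hmem : tilt θ u z ⁻¹' U ∈ nhdsWithin 0 (Set.Ici 0) :=
    mem_nhdsWithin_of_mem_nhds
      ((hU.preimage (continuous_tilt θ u z)).mem_nhds (by simpa [tilt_zero] using hθ))
  obtain ⟨δ₀, hδ₀ : 0 < δ₀, hsub⟩ := mem_nhdsGE_iff_exists_Icc_subset.1 hmem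
  refine ⟨θ, u, z, δ₀, ‖z‖ / (N + 2 * δ₀), hu, hδ₀, by positivity, fun i => rfl,
    fun δ hδ => ⟨hsub hδ, fun i => ?_⟩⟩
  have hsep := hle u δ hu hδ.1 (hnegP _ (hsub hδ))
  rw [huz, abs_norm] at hsep
  rw [div_mul_eq_mul_div, div_le_iff₀ (by positivity), mul_comm, mul_comm ‖_ - _‖]
  exact hsep.trans (by gcongr; exacts [hδ.2, le_rfl])

end Separation

section RateOptimisation

theorem ofReal_mul_min_le_mul {E W : ℝ≥0∞} {a b κ s₀ : ℝ} (hb : 0 < b) (hκ : 0 ≤ κ) (hs₀ : 0 ≤ s₀)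
    (hE : E ≠ 0) (hW : ENNReal.ofReal b ≤ W)
    (hbound : ∀ s ∈ Set.Icc 0 s₀, ENNReal.ofReal s * W ≤ ENNReal.ofReal κ →
      ENNReal.ofReal (a * s) ≤ E) :
    ENNReal.ofReal (a * min κ (s₀ * b)) ≤ E * W := by
  rcases eq_or_ne W ⊤ with rfl | hWtop
  · rw [ENNReal.mul_top hE]
    exact le_top
  have hbw : b ≤ W.toReal := (ENNReal.ofReal_le_iff_le_toReal hWtop).1 hW
  have hw : 0 < W.toReal := hb.trans_le hbw
  set s := min κ (s₀ * b) / W.toReal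
  have hs : s ∈ Set.Icc 0 s₀ := by
    refine ⟨by positivity, (div_le_iff₀ hw).2 ((min_le_right _ _).trans ?_)⟩
    gcongr
  have hsW : s * W.toReal = min κ (s₀ * b) := div_mul_cancel₀ _ hw.ne'
  have hle : ENNReal.ofReal (a * s) ≤ E := hbound s hs <| by
    rw [← ENNReal.ofReal_toReal hWtop, ← ENNReal.ofReal_mul hs.1, hsW]
    exact ENNReal.ofReal_le_ofReal (min_le_left _ _)
  calc ENNReal.ofReal (a * min κ (s₀ * b))
      = ENNReal.ofReal (a * s) * W := by
        rw [← hsW, ← mul_assoc, ENNReal.ofReal_mul' hw.le, ENNReal.ofReal_toReal hWtop]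
    _ ≤ E * W := mul_le_mul_left hle W

theorem ofReal_sqrt_le_of_le_mul_self {W : ℝ≥0∞} {D : ℝ} (h : ENNReal.ofReal D ≤ W * W) :
    ENNReal.ofReal √D ≤ W := by
  by_contra! hlt
  refine h.not_gt ((ENNReal.mul_lt_mul hlt hlt).trans_eq ?_)
  rw [← ENNReal.ofReal_mul (Real.sqrt_nonneg D), Real.mul_self_sqrt]
  exact (Real.sqrt_pos.1 (ENNReal.ofReal_pos.1 (pos_of_gt hlt))).le

end RateOptimisation

section WorstCase

variable {n K : ℕ} {Θ : Set (Param n K)} {Pi : Set (Vec n)} {σ : ℝ}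
  {init : ProbabilityMeasure (Fin K)} {μ : Policy n K}

theorem worstEstimationMSE_mono {T T' : ℕ} (h : T ≤ T') (r : Rules n K) :
    worstEstimationMSE Θ Pi σ init μ r T ≤ worstEstimationMSE Θ Pi σ init μ r T' :=
  iSup₂_mono fun _ _ => Finset.sum_le_sum_of_subset (Finset.range_mono h)

theorem le_worstEstimationMSE_of_tilt {θ : Param n K} {P : Matrix (Fin K) (Fin K) ℝ}
    {hP : P ∈ Matrix.rowStochastic ℝ (Fin K)} {u z : Vec n} (hu : ‖u‖ = 1) {v : ℝ≥0} (hv : v ≠ 0)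
    (hopt : ∀ i, optInput θ P i = z) {δ b : ℝ} (hb : 0 ≤ b)
    (hsep : ∀ i, b ≤ ‖z - optInput (tilt θ u z δ) P i‖)
    (hm : (gaussianModel θ hP u v).Admissible Θ Pi σ)
    (hmδ : (gaussianModel (tilt θ u z δ) hP u v).Admissible Θ Pi σ) (r : Rules n K) {T : ℕ}
    (hinfo : ∀ t < T, ENNReal.ofReal (δ ^ 2 / v) * worstInputMSE Θ Pi σ init μ t ≤
      ENNReal.ofReal (1 / 4)) :
    ENNReal.ofReal (T * (3 / 32 * b ^ 2)) ≤ worstEstimationMSE Θ Pi σ init μ r T := by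
  have H := hasLogLikelihoodRatio_tilt θ hP hu hv z δ
  have hquad : ∀ (i : Fin K) (x : Vec n), (δ * inner ℝ u (x - z)) ^ 2 / v ≤
      δ ^ 2 / v * ‖x - optInput θ P i‖ ^ 2 := fun i x => by
    have hcs := abs_real_inner_le_norm u (x - z)
    rw [hu, one_mul] at hcs
    rw [hopt, mul_pow, mul_div_right_comm]
    gcongr ?_ * ?_
    exact sq_le_sq.2 (by simpa using hcs)
  have htwo := H.le_cumMSE_add_cumMSE hb (fun i => (hopt i).symm ▸ hsep i) init μ r
    fun t ht => (H.lintegral_sum_quadVar_le (by positivity) hquad init μ t).trans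
      ((mul_le_mul_right (le_iSup₂ (f := fun m _ => cumMSE m init μ μ t) _ hm) _).trans
        (hinfo t ht))
  have hsum := htwo.trans (add_le_add (le_iSup₂ (f := fun m _ => cumMSE m init μ r T) _ hm)
    (le_iSup₂ (f := fun m _ => cumMSE m init μ r T) _ hmδ))
  rw [← two_mul, show (T : ℝ) * (3 / 16 * b ^ 2) = 2 * (T * (3 / 32 * b ^ 2)) by ring,
    ENNReal.ofReal_mul zero_le_two, ENNReal.ofReal_ofNat] at hsum
  exact (ENNReal.mul_le_mul_iff_right two_ne_zero ENNReal.ofNat_ne_top).1 hsum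

theorem exists_le_worstEstimationMSE_of_mul_worstInputMSE_le [NeZero n] [NeZero K] (hσ : 0 < σ)
    {U : Set (Param n K)} (hU : IsOpen U) (hne : U.Nonempty)
    (hneg : ∀ θ ∈ U, ∀ k, NegDef (θ k).1)
    (hopt : ∀ θ ∈ U, θ ∈ Θ ∧ ∀ i, optInput θ (uniformTransition K) i ∈ Pi) :
    ∃ a s₀ : ℝ, 0 < a ∧ 0 < s₀ ∧
      ∀ (init : ProbabilityMeasure (Fin K)) (μ : Policy n K) (r : Rules n K) (T : ℕ),
        ∀ s ∈ Set.Icc 0 s₀,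
          (∀ t < T, ENNReal.ofReal s * worstInputMSE Θ Pi σ init μ t ≤ ENNReal.ofReal (1 / 4)) →
            ENNReal.ofReal (T * a * s) ≤ worstEstimationMSE Θ Pi σ init μ r T := by
  obtain ⟨θ, u, z, δ₀, c, hu, hδ₀, hc, hz, htilt⟩ := exists_tilt_mem_separated hU hne hneg
  set v : ℝ≥0 := ⟨σ ^ 2, sq_nonneg σ⟩
  have hv : v ≠ 0 := NNReal.coe_ne_zero.1 (pow_pos hσ 2).ne'
  have hadm : ∀ δ ∈ Set.Icc 0 δ₀,
      (gaussianModel (tilt θ u z δ) uniformTransition_stochastic u v).Admissible Θ Pi σ :=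
    fun δ hδ => gaussianModel_admissible _ hu.le le_rfl (hopt _ (htilt δ hδ).1).1
      (hopt _ (htilt δ hδ).1).2
  have hadm₀ : (gaussianModel θ uniformTransition_stochastic u v).Admissible Θ Pi σ := by
    simpa only [tilt_zero] using hadm 0 ⟨le_rfl, hδ₀.le⟩
  refine ⟨3 / 32 * (c * σ) ^ 2, (δ₀ / σ) ^ 2, by positivity, by positivity,
    fun init μ r T s hs hinfo => ?_⟩
  have hδ : σ * √s ∈ Set.Icc 0 δ₀ := by
    refine ⟨by positivity, ?_⟩
    rw [mul_comm, ← le_div_iff₀ hσ]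
    exact Real.sqrt_le_iff.2 ⟨by positivity, hs.2⟩
  have hδv : (σ * √s) ^ 2 / v = s := by
    rw [mul_pow, Real.sq_sqrt hs.1]
    exact mul_div_cancel_left₀ s (pow_pos hσ 2).ne'
  have hle := le_worstEstimationMSE_of_tilt hu hv hz (mul_nonneg hc.le hδ.1) (htilt _ hδ).2 hadm₀
    (hadm _ hδ) r (T := T) (init := init) (μ := μ) (by rwa [hδv])
  rwa [← mul_assoc c, mul_pow (c * σ), Real.sq_sqrt hs.1, ← mul_assoc (3 / 32 : ℝ),
    ← mul_assoc (T : ℝ)] at hle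

theorem exists_mul_le_worstEstimationMSE_mul_worstInputMSE [NeZero n] [NeZero K] (hσ : 0 < σ)
    {U : Set (Param n K)} (hU : IsOpen U) (hne : U.Nonempty)
    (hneg : ∀ θ ∈ U, ∀ k, NegDef (θ k).1)
    (hopt : ∀ θ ∈ U, θ ∈ Θ ∧ ∀ i, optInput θ (uniformTransition K) i ∈ Pi) :
    ∃ D : ℝ, 0 < D ∧
      ∀ (init : ProbabilityMeasure (Fin K)) (μ : Policy n K) (r : Rules n K) (T : ℕ),
        ENNReal.ofReal (D * T) ≤
          worstEstimationMSE Θ Pi σ init μ r T * worstInputMSE Θ Pi σ init μ T := by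
  obtain ⟨a, s₀, ha, hs₀, hbound⟩ :=
    exists_le_worstEstimationMSE_of_mul_worstInputMSE_le hσ hU hne hneg hopt
  refine ⟨a * min (1 / 4) (s₀ * (a * s₀)), by positivity, fun init μ r T => ?_⟩
  rcases Nat.eq_zero_or_pos T with rfl | hT
  · simp
  have hbase : ∀ r : Rules n K,
      ENNReal.ofReal (a * s₀) ≤ worstEstimationMSE Θ Pi σ init μ r T := fun r => by
    have hone := hbound init μ r 1 s₀ ⟨hs₀.le, le_rfl⟩
      (by simp [worstInputMSE, cumMSE])
    rw [Nat.cast_one, one_mul] at hone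
    exact hone.trans (worstEstimationMSE_mono hT r)
  have hE : worstEstimationMSE Θ Pi σ init μ r T ≠ 0 :=
    ((ENNReal.ofReal_pos.2 (by positivity)).trans_le (hbase r)).ne'
  rw [mul_right_comm, mul_comm a]
  refine ofReal_mul_min_le_mul (by positivity) (by positivity) hs₀.le hE (hbase μ) fun s hs hinfo =>
    hbound init μ r T s hs fun t ht => ?_
  exact (mul_le_mul_right (worstEstimationMSE_mono ht.le μ) _).trans hinfo

end WorstCase

section Regret

variable {n K : ℕ} {Θ Θ' : Set (Param n K)} {Pi : Set (Vec n)} {σ : ℝ}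

theorem exists_forall_inner_le_of_isCompact (hΘ : IsCompact Θ)
    (hneg : ∀ θ ∈ Θ, ∀ k, NegDef (θ k).1) :
    ∃ c : ℝ, 0 < c ∧
      ∀ θ ∈ Θ, ∀ k, ∀ x : Vec n, inner ℝ x ((θ k).1.toEuclideanLin x) ≤ -(c * ‖x‖ ^ 2) := by
  have hcompact : IsCompact (⋃ k, (fun θ : Param n K => (θ k).1) '' Θ) :=
    isCompact_iUnion fun k => hΘ.image (by fun_prop)
  obtain ⟨c, hc, hle⟩ := exists_inner_le_of_isCompact hcompact fun A hA => by
    obtain ⟨k, θ, hθ, rfl⟩ := Set.mem_iUnion.1 hA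
    exact hneg θ hθ k
  exact ⟨c, hc, fun θ hθ k => hle _ (Set.mem_iUnion.2 ⟨k, θ, hθ, rfl⟩)⟩

theorem worstRegret_mono (hΘ : Θ' ⊆ Θ) (init : ProbabilityMeasure (Fin K)) (μ : Policy n K)
    (T : ℕ) : worstRegret Θ' Pi σ init μ T ≤ worstRegret Θ Pi σ init μ T :=
  biSup_mono fun _ hm => { hm with mem := hΘ hm.mem }

theorem mul_worstInputMSE_le_worstRegret {c : ℝ} (hc : 0 < c)
    (hcoer : ∀ θ ∈ Θ, ∀ k, ∀ x : Vec n, inner ℝ x ((θ k).1.toEuclideanLin x) ≤ -(c * ‖x‖ ^ 2))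
    (init : ProbabilityMeasure (Fin K)) (μ : Policy n K) (T : ℕ) :
    ENNReal.ofReal c * worstInputMSE Θ Pi σ init μ T ≤ worstRegret Θ Pi σ init μ T := by
  simp only [worstInputMSE, ENNReal.mul_iSup]
  exact iSup₂_mono fun m hm => Model.mul_cumMSE_le_regret
    (fun k => (hm.memLp k).integrable one_le_two) hm.mean_zero hc (hcoer _ hm.mem) init μ T

theorem exists_mul_sqrt_le_worstRegret [NeZero n] [NeZero K] (hσ : 0 < σ) {U : Set (Param n K)}
    (hU : IsOpen U) (hne : U.Nonempty) (hneg : ∀ θ ∈ U, ∀ k, NegDef (θ k).1)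
    (hopt : ∀ θ ∈ U, θ ∈ Θ ∧ ∀ i, optInput θ (uniformTransition K) i ∈ Pi) :
    ∃ C : ℝ, 0 < C ∧ ∀ (init : ProbabilityMeasure (Fin K)) (μ : Policy n K) (T : ℕ),
      ENNReal.ofReal (C * √T) ≤ worstRegret Θ Pi σ init μ T := by
  obtain ⟨θ, hθ⟩ := hne
  have : LocallyCompactSpace (Matrix (Fin n) (Fin n) ℝ) :=
    inferInstanceAs (LocallyCompactSpace (Fin n → Fin n → ℝ))
  obtain ⟨Θ₀, hΘ₀, hθΘ₀, hΘ₀U⟩ := exists_compact_subset hU hθ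
  obtain ⟨c, hc, hcoer⟩ :=
    exists_forall_inner_le_of_isCompact hΘ₀ fun θ hθ => hneg θ (hΘ₀U hθ)
  obtain ⟨D, hD, hprod⟩ := exists_mul_le_worstEstimationMSE_mul_worstInputMSE (Θ := Θ₀) (Pi := Pi)
    hσ isOpen_interior ⟨θ, hθΘ₀⟩ (fun θ hθ => hneg θ (hΘ₀U (interior_subset hθ)))
    fun θ hθ => ⟨interior_subset hθ, (hopt θ (hΘ₀U (interior_subset hθ))).2⟩
  refine ⟨c * √D, by positivity, fun init μ T => ?_⟩
  calc ENNReal.ofReal (c * √D * √T)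
      = ENNReal.ofReal c * ENNReal.ofReal √(D * T) := by
        rw [mul_assoc, ← Real.sqrt_mul hD.le, ENNReal.ofReal_mul hc.le]
    _ ≤ ENNReal.ofReal c * worstInputMSE Θ₀ Pi σ init μ T := by
        gcongr
        exact ofReal_sqrt_le_of_le_mul_self (hprod init μ μ T)
    _ ≤ worstRegret Θ₀ Pi σ init μ T := mul_worstInputMSE_le_worstRegret hc hcoer init μ T
    _ ≤ worstRegret Θ Pi σ init μ T :=
        worstRegret_mono (fun θ hθ => (hopt θ (hΘ₀U hθ)).1) init μ T

end Regret

end MarkovJump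

theorem mainTheorem8_general (n K : ℕ) (hn : 1 ≤ n) (hK : 1 ≤ K)
    (Θ : Set (MarkovJump.Param n K)) (Pi : Set (MarkovJump.Vec n)) (σ : ℝ) (hσ : 0 < σ)
    (hneg : ∀ θ ∈ Θ, ∀ k, MarkovJump.NegDef (θ k).1)
    (hint : (interior {θ : MarkovJump.Param n K | θ ∈ Θ ∧
      ∀ i, MarkovJump.optInput θ (MarkovJump.uniformTransition K) i ∈ Pi}).Nonempty) :
    ∃ C C' : ℝ, 0 < C ∧ 0 < C' ∧
      ∀ (init : ProbabilityMeasure (Fin K)) (μ : MarkovJump.Policy n K) (T : ℕ),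
        (∀ e : MarkovJump.Estimator n K,
          ENNReal.ofReal (C ^ 2 * T) ≤
            MarkovJump.worstEstimationMSE Θ Pi σ init μ e T *
              MarkovJump.worstInputMSE Θ Pi σ init μ T) ∧
        ENNReal.ofReal (C * Real.sqrt T) ≤ MarkovJump.worstInputMSE Θ Pi σ init μ T ∧
        ENNReal.ofReal (C' * Real.sqrt T) ≤ MarkovJump.worstRegret Θ Pi σ init μ T := by
  have : NeZero n := ⟨Nat.one_le_iff_ne_zero.1 hn⟩
  have : NeZero K := ⟨Nat.one_le_iff_ne_zero.1 hK⟩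
  have hopt := interior_subset (s := {θ : MarkovJump.Param n K | θ ∈ Θ ∧
    ∀ i, MarkovJump.optInput θ (MarkovJump.uniformTransition K) i ∈ Pi})
  obtain ⟨D, hD, hprod⟩ := MarkovJump.exists_mul_le_worstEstimationMSE_mul_worstInputMSE
    hσ isOpen_interior hint (fun θ hθ => hneg θ (hopt hθ).1) fun _ hθ => hopt hθ
  obtain ⟨C', hC', hregret⟩ := MarkovJump.exists_mul_sqrt_le_worstRegret
    hσ isOpen_interior hint (fun θ hθ => hneg θ (hopt hθ).1) fun _ hθ => hopt hθ
  refine ⟨√D, C', Real.sqrt_pos.2 hD, hC', fun init μ T =>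
    ⟨fun e => ?_, ?_, hregret init μ T⟩⟩
  · rw [Real.sq_sqrt hD.le]
    exact hprod init μ e T
  · rw [← Real.sqrt_mul hD.le]
    exact MarkovJump.ofReal_sqrt_le_of_le_mul_self (hprod init μ μ T)

theorem mainTheorem8 (n K : ℕ) (hn : 1 ≤ n) (hK : 1 ≤ K)
    (Θ : Set (MarkovJump.Param n K)) (Pi : Set (MarkovJump.Vec n)) (σ : ℝ) (hσ : 0 < σ)
    (hΘ : IsCompact Θ) (hneg : ∀ θ ∈ Θ, ∀ k, MarkovJump.NegDef (θ k).1)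
    (hPi : IsCompact Pi) (hPi' : Convex ℝ Pi)
    (hint : (interior {θ : MarkovJump.Param n K | θ ∈ Θ ∧
      ∀ i, MarkovJump.optInput θ (MarkovJump.uniformTransition K) i ∈ Pi}).Nonempty) :
    ∃ C C' : ℝ, 0 < C ∧ 0 < C' ∧
      ∀ (init : ProbabilityMeasure (Fin K)) (μ : MarkovJump.Policy n K) (T : ℕ),
        (∀ e : MarkovJump.Estimator n K,
          ENNReal.ofReal (C ^ 2 * T) ≤
            MarkovJump.worstEstimationMSE Θ Pi σ init μ e T *
              MarkovJump.worstInputMSE Θ Pi σ init μ T) ∧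
        ENNReal.ofReal (C * Real.sqrt T) ≤ MarkovJump.worstInputMSE Θ Pi σ init μ T ∧
        ENNReal.ofReal (C' * Real.sqrt T) ≤ MarkovJump.worstRegret Θ Pi σ init μ T :=
  mainTheorem8_general n K hn hK Θ Pi σ hσ hneg hint
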